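/- Let $\mathcal T$ be an ideal triangulation of a connected, compact, oriented 3-manifold $M$: finitely many simplices, each identified with a standard simplex, glued along pairs of faces by affine homeomorphisms, with quotient the space $\widehat M$ obtained from $M$ by collapsing each boundary component to a point; the 0-cells $x_1,\dots,x_v$ of $\widehat M$ are the cusps. Let $n\ge 2$. Identify every simplex with $\{t\in\mathbb R^4_{\ge0}: t_0+t_1+t_2+t_3=n\}$. The integral points of $M$ are the images of the points $(t,k)$, where $t$ is an integral point of simplex $k$ other than a vertex. Let $C_1^n$ be the free abelian group on the integral points, $C_0$ the free abelian group on the cusps, $C_0^n=C_0\otimes\mathbb Z^{n-1}$, and let $\alpha^*\colon C_1^n\to C_0^n$ be the homomorphism sending the integral point $(t,k)$ to $\sum_{i=0}^3 x_{i,k}\otimes e_{t_i}$, where $x_{i,k}$ is the cusp at vertex $i$ of simplex $k$ and $e_0=0$. A homomorphism $f$ from a free abelian group is basic if there is a set $J$ of standard generators, called basic generators, such that $f$ maps $\mathrm{Span}(J)$ isomorphically onto the image of $f$. (1) The map $\alpha^*$ is basic. (2) In each of the following cases sets of integral points as described exist; for every such set the corresponding columns of $\alpha^*$ form a square matrix of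 determinant $\pm n$, and the set is a set of basic generators. (Points of a face with vertices $a,b,c$ are written $(t_a,t_b,t_c)$; maximal trees are taken in the 1-skeleton of $\widehat M$; a self edge is a 1-cell joining a cusp to itself.) (a) One cusp: the points $(1,j,n-1-j)$ with $1\le j\le\frac{n-1}2$ and $(0,j,n-j)$ with $1\le j\le\frac n2$ on any face. (b) More than one cusp, with a self edge (tree with 1-cycle): for a face for which $a$ and $b$ are at the same cusp and $c$ is at another cusp, and a maximal tree $G$ containing the edge $bc$: the points $(1,j,n-1-j)$, $1\le j\le n-1$, of the face together with all integral points on the edges of $G$. (c) More than one cusp, no self edge (tree with 3-cycle): for a face whose vertices are at three distinct cusps and a maximal tree $G$ containing the edges $ab$ and $bc$: the points $(j,n-1-j,1)$, $1\le j\le n-1$, of the face together with all integral points on the edges of $G$. (3) Let $P_n(\mathcal T)$ be the Ptolemy variety: the set of assignments of $c_{t,k}\in\mathbb C\setminus\{0\}$ to all pairs $(t,k)$ as above, satisfying the Ptolemy relations $$c_{a+1001,k}c_{a+0110,k}+c_{a+1100,k}c_{a+0011,k}=c_{a+1010,k}c_{a+0101,k}\qquad (a\in\mathbb Z_{\ge0}^4,\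 a_0+a_1+a_2+a_3=n-2)$$ and, whenever a face pairing carries $(t,k)$ to $(t',k')$ and vertex $i$ to vertex $\sigma(i)$, the identification relation $c_{t,k}=\epsilon\, c_{t',k'}$, where $\epsilon=\prod_{i<j,\ \sigma(i)>\sigma(j)}(-1)^{t_it_j}$. Let the torus $T=(\mathbb C^*)^{v(n-1)}$, with coordinates indexed by the natural generators of $C_0^n$, act on it by the diagonal action, i.e. by scaling $c_{t,k}$ by the monomial whose exponent vector is $\alpha^*(t,k)$. Let $P_n(\mathcal T)_{\mathrm{red}}=P_n(\mathcal T)/T$, let $\mathcal O$ be the coordinate ring of $P_n(\mathcal T)$, i.e. the polynomial ring in the $c_{t,k}^{\pm1}$ modulo the Ptolemy and identification relations, and let $\mathcal O^T$ be its ring of invariants. Then for every set $S$ of integral points that are basic generators for $\alpha^*$, and every choice of a representative $(t,k)$ of each integral point (so that $c_p$ is defined for every integral point $p$), the reduced Ptolemy variety is the subvariety $\{c_p=1,\ p\in S\}$ of $P_n(\mathcal T)$: the natural map $\{c\in P_n(\mathcal T): c_p=1,\ p\in S\}\to P_n(\mathcal T)/T$ is a bijection; restriction maps the $T$-invariant regular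 functions on $P_n(\mathcal T)$ bijectively onto the regular functions on this subvariety; and the natural map $\mathcal O^T\to\mathcal O/(c_p-1:\ p\in S)$ is an isomorphism. -/

import Mathlib

open scoped TensorProduct

/-- A (concrete) ideal triangulation of a compact oriented 3-manifold `M`: the simplices are
indexed by `K`, each is identified with a standard simplex with vertices `Fin 4`, and the face of
simplex `k` opposite vertex `i` is glued to the face of `nbr k i` opposite vertex `perm k i i`.
The affine gluing map sends vertex `j ≠ i` to vertex `perm k i j`.  The value of `perm k i` at `i`
is the vertex opposite the target face.  `orient k` is the sign of the identification of simplex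
`k` with the standard simplex (constantly `1` for an oriented triangulation); the gluing maps are
orientation reversing on faces. -/
structure IdealTriangulation (K : Type*) where
  nbr : K → Fin 4 → K
  perm : K → Fin 4 → Equiv.Perm (Fin 4)
  nbr_nbr : ∀ k i, nbr (nbr k i) (perm k i i) = k
  perm_perm : ∀ k i, perm (nbr k i) (perm k i i) = (perm k i)⁻¹
  ne_self : ∀ k i, (nbr k i, perm k i i) ≠ (k, i)
  orient : K → ℤˣ
  sign_perm : ∀ k i, Equiv.Perm.sign (perm k i) = -(orient k * orient (nbr k i))

/-- The nonvertex integral points `t` of the simplex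
`{(t₀, t₁, t₂, t₃) | 0 ≤ tᵢ ≤ n, t₀ + t₁ + t₂ + t₃ = n}`. -/
abbrev SimplexPoint (n : ℕ) : Type :=
  {t : Fin 4 → ℕ // ∑ i, t i = n ∧ ∀ i, t i ≠ n}

/-- The point with coordinates permuted: vertex `i` is moved to vertex `σ i`. -/
def SimplexPoint.permute {n : ℕ} (σ : Equiv.Perm (Fin 4)) (t : SimplexPoint n) : SimplexPoint n :=
  ⟨fun j => t.1 (σ.symm j), by
    exact ⟨(Equiv.sum_comp σ.symm t.1).trans t.2.1, fun i => t.2.2 _⟩⟩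

/-- The point `a + (unit vector i) + (unit vector j)`, where `a` has coordinate sum `n - 2`. -/
def SimplexPoint.addEdge {n : ℕ} (a : Fin 4 → ℕ) (ha : ∑ i, a i + 2 = n) (i j : Fin 4)
    (hij : i ≠ j) : SimplexPoint n :=
  ⟨fun l => a l + (if l = i then 1 else 0) + (if l = j then 1 else 0), by
    constructor
    · simp [Finset.sum_add_distrib, ← ha, add_assoc]
    · intro l
      have h1 : a l ≤ ∑ i, a i := Finset.single_le_sum (fun _ _ => Nat.zero_le _)
        (Finset.mem_univ l)
      by_cases hi : l = i <;> by_cases hj : l = j <;> simp [hi, hj] <;> grind⟩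

/-- The vector `e_m` in `ℤ^{n-1}` for `1 ≤ m ≤ n - 1`, with the convention `e_0 = 0`. -/
def unitVec (n m : ℕ) : Fin (n - 1) → ℤ := fun j => if (j : ℕ) + 1 = m then 1 else 0

/-- A set `J` of standard generators is a set of basic generators of `f` if `f` maps the span of
`J` isomorphically onto the image of `f`. -/
def IsBasicGenerators {ι N : Type*} [AddCommGroup N] (f : (ι →₀ ℤ) →ₗ[ℤ] N) (J : Set ι) : Prop :=
  Set.InjOn f (Submodule.span ℤ ((fun j => Finsupp.single j (1 : ℤ)) '' J)) ∧
    (Submodule.span ℤ ((fun j => Finsupp.single j (1 : ℤ)) '' J)).map f = LinearMap.range f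

/-- A homomorphism out of `ℤ^ι` is basic if it has a set of basic generators. -/
def IsBasic {ι N : Type*} [AddCommGroup N] (f : (ι →₀ ℤ) →ₗ[ℤ] N) : Prop :=
  ∃ J : Set ι, IsBasicGenerators f J

/-- The sign by which the determinant of a matrix with four blocks of `t 0, …, t 3` columns
changes when block `i` is moved to position `σ i`. -/
def blockSign (σ : Equiv.Perm (Fin 4)) (t : Fin 4 → ℕ) : ℂ :=
  ∏ i, ∏ j, if i < j ∧ σ j < σ i then (-1) ^ (t i * t j) else 1

namespace IdealTriangulation

variable {K : Type*} (T : IdealTriangulation K) (n : ℕ)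

/-- The glued space is connected and nonempty. -/
def IsConnected : Prop :=
  Nonempty K ∧ ∀ k l, Relation.ReflTransGen (fun a b => ∃ i, b = T.nbr a i) k l

/-- The cusps, i.e. the 0-cells: vertices of simplices up to face pairings. -/
def Cusp : Type _ :=
  Quot (fun a b : K × Fin 4 => ∃ i, i ≠ a.2 ∧ b = (T.nbr a.1 i, T.perm a.1 i a.2))

/-- The cusp determined by vertex `i` of simplex `k`. -/
def cusp (k : K) (i : Fin 4) : T.Cusp := Quot.mk _ (k, i)

/-- The unoriented 1-cells: edges of simplices up to reversal and face pairings. -/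
def OneCell : Type _ :=
  Quot (fun a b : K × {e : Fin 4 × Fin 4 // e.1 ≠ e.2} =>
    (a.1 = b.1 ∧ b.2.1 = a.2.1.swap) ∨
    ∃ i, i ≠ a.2.1.1 ∧ i ≠ a.2.1.2 ∧ b.1 = T.nbr a.1 i ∧
      b.2.1 = (T.perm a.1 i a.2.1.1, T.perm a.1 i a.2.1.2))

/-- The 1-cell that is the image of the edge of simplex `k` joining vertices `i` and `j`. -/
def oneCell (k : K) (i j : Fin 4) (h : i ≠ j) : T.OneCell := Quot.mk _ (k, ⟨(i, j), h⟩)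

/-- The unordered pair of cusps joined by a 1-cell. -/
def ends : T.OneCell → Sym2 T.Cusp :=
  Quot.lift (fun a => s(T.cusp a.1 a.2.1.1, T.cusp a.1 a.2.1.2)) (by
    rintro ⟨k, ⟨⟨i, j⟩, h⟩⟩ ⟨k', ⟨⟨i', j'⟩, h'⟩⟩ hab
    rcases hab with ⟨h1, h2⟩ | ⟨l, h1, h2, h3, h4⟩
    · simp only [Prod.swap_prod_mk, Prod.mk.injEq] at h1 h2
      obtain ⟨rfl, rfl⟩ := h2
      subst h1
      exact Sym2.eq_swap
    · simp only [Prod.mk.injEq] at h1 h2 h3 h4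
      obtain ⟨rfl, rfl⟩ := h4
      subst h3
      have e1 : T.cusp k i = T.cusp (T.nbr k l) (T.perm k l i) := Quot.sound ⟨l, h1, rfl⟩
      have e2 : T.cusp k j = T.cusp (T.nbr k l) (T.perm k l j) := Quot.sound ⟨l, h2, rfl⟩
      simp only [e1, e2])

/-- The graph formed by all cusps and the 1-cells in `G` is connected. -/
def Spans (G : Set T.OneCell) : Prop :=
  ∀ x y : T.Cusp, Relation.ReflTransGen (fun a b => ∃ e ∈ G, T.ends e = s(a, b)) x y

/-- Maximal (i.e. spanning) trees in the 1-skeleton: minimal connected spanning subgraphs. -/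
def IsMaximalTree (G : Set T.OneCell) : Prop := Minimal T.Spans G

/-- Pairs `(k, t)` of a simplex and a nonvertex integral point of it. -/
abbrev LabelledPoint (_T : IdealTriangulation K) (n : ℕ) : Type _ := K × SimplexPoint n

/-- The image of `(k, t)` under the pairing of the face opposite vertex `i` of simplex `k`
(meaningful when `t` lies on this face, i.e. `t i = 0`). -/
def glue {n : ℕ} (p : T.LabelledPoint n) (i : Fin 4) : T.LabelledPoint n :=
  (T.nbr p.1 i, p.2.permute (T.perm p.1 i))

/-- The integral points of `M`. -/
def IntegralPoint : Type _ :=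
  Quot (fun p q : T.LabelledPoint n => ∃ i, p.2.1 i = 0 ∧ q = T.glue p i)

/-- The integral point of `M` that is the image of `(k, t)`. -/
def toIntegralPoint {n : ℕ} (p : T.LabelledPoint n) : T.IntegralPoint n := Quot.mk _ p

/-- `C₁ⁿ`, the free abelian group on the integral points of `M`. -/
abbrev C1 : Type _ := T.IntegralPoint n →₀ ℤ

/-- `C₀ⁿ = C₀ ⊗ ℤ^{n-1}`, where `C₀` is the free abelian group on the cusps. -/
abbrev C0 : Type _ := (T.Cusp →₀ ℤ) ⊗[ℤ] (Fin (n - 1) → ℤ)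

/-- The element `∑ᵢ xᵢ ⊗ e_{tᵢ}`, where `xᵢ` is the cusp at vertex `i` of simplex `k`. -/
noncomputable def labelledWeight {n : ℕ} (p : T.LabelledPoint n) : T.C0 n :=
  ∑ i, Finsupp.single (T.cusp p.1 i) 1 ⊗ₜ[ℤ] unitVec n (p.2.1 i)

theorem unitVec_zero (n : ℕ) : unitVec n 0 = 0 := by
  funext j
  simp [unitVec]

theorem cusp_glue (k : K) {i j : Fin 4} (h : i ≠ j) :
    T.cusp (T.nbr k i) (T.perm k i j) = T.cusp k j :=
  (Quot.sound ⟨i, h, rfl⟩ : T.cusp k j = _).symm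

theorem labelledWeight_glue {n : ℕ} (p : T.LabelledPoint n) (i : Fin 4) (h : p.2.1 i = 0) :
    T.labelledWeight (T.glue p i) = T.labelledWeight p := by
  unfold labelledWeight glue SimplexPoint.permute
  rw [← Equiv.sum_comp (T.perm p.1 i)]
  refine Finset.sum_congr rfl fun j _ => ?_
  simp only [Equiv.symm_apply_apply]
  by_cases hj : i = j
  · subst hj
    simp [h, unitVec_zero]
  · rw [cusp_glue T _ hj]

/-- The value of `α*` on an integral point. -/
noncomputable def weight {n : ℕ} : T.IntegralPoint n → T.C0 n :=
  Quot.lift T.labelledWeight (by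
    rintro p q ⟨i, h, rfl⟩
    exact (T.labelledWeight_glue p i h).symm)

/-- The map `α* : C₁ⁿ → C₀ⁿ = C₀ ⊗ ℤ^{n-1}`. -/
noncomputable def alphaStar : T.C1 n →ₗ[ℤ] T.C0 n :=
  Finsupp.linearCombination ℤ T.weight

/-- The natural basis `x ⊗ e_j` of `C₀ⁿ`. -/
noncomputable def basisC0 : Module.Basis (T.Cusp × Fin (n - 1)) ℤ (T.C0 n) :=
  Module.Basis.tensorProduct Finsupp.basisSingleOne (Pi.basisFun ℤ (Fin (n - 1)))

noncomputable instance [Finite K] : Fintype T.Cusp :=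
  @Fintype.ofFinite T.Cusp (Quot.finite _)

open Classical in
/-- The columns of `α*` corresponding to the integral points in `S` form a square matrix of
determinant `± d` (the rows are indexed by the natural generators `x ⊗ e_j`, and the set `S` is
enumerated by the same index set). -/
def ColumnsHaveDet {n : ℕ} [Finite K] (S : Set (T.IntegralPoint n)) (d : ℕ) : Prop :=
  ∃ e : T.Cusp × Fin (n - 1) ≃ S,
    |(Matrix.of fun r c =>
      (T.basisC0 n).repr (T.alphaStar n (Finsupp.single (e c : T.IntegralPoint n) 1)) r).det| = d

/-! ### The explicit sets of integral points -/

/-- The integral points on the 1-cells in `G`. -/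
def edgePoints (G : Set T.OneCell) : Set (T.IntegralPoint n) :=
  {P | ∃ (p : T.LabelledPoint n) (i j : Fin 4) (h : i ≠ j), T.toIntegralPoint p = P ∧
    p.2.1 i + p.2.1 j = n ∧ T.oneCell p.1 i j h ∈ G}

/-- The integral points on the face of simplex `k` with (distinct) vertices `a`, `b`, `c` whose
coordinates at `a`, `b`, `c` satisfy `Q`. -/
def facePoints (k : K) (a b c : Fin 4) (Q : ℕ → ℕ → ℕ → Prop) : Set (T.IntegralPoint n) :=
  {P | ∃ t : SimplexPoint n, T.toIntegralPoint (k, t) = P ∧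
    t.1 a + t.1 b + t.1 c = n ∧ Q (t.1 a) (t.1 b) (t.1 c)}

/-- One cusp: the points `(1, j, n-1-j)` with `1 ≤ j ≤ (n-1)/2` and `(0, j, n-j)` with
`1 ≤ j ≤ n/2` on a face. -/
def IsOneCuspFamily (S : Set (T.IntegralPoint n)) : Prop :=
  ∃ (k : K) (a b c : Fin 4), a ≠ b ∧ b ≠ c ∧ a ≠ c ∧
    S = T.facePoints n k a b c (fun x y z => x ≤ 1 ∧ 1 ≤ y ∧ y ≤ z)

/-- Tree with 1-cycle: for a face whose vertices `a`, `b` lie at a cusp `x₁` and whose vertex `c`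
lies at a cusp `x₂ ≠ x₁`, and a maximal tree `G` containing the edge `bc` of the face, the points
`(1, j, n-1-j)`, `1 ≤ j ≤ n-1`, of the face together with the edge points on `G`. -/
def IsOneCycleFamily (S : Set (T.IntegralPoint n)) : Prop :=
  ∃ (k : K) (a b c : Fin 4) (G : Set T.OneCell) (_ : a ≠ b) (hbc : b ≠ c) (_ : a ≠ c),
    T.cusp k a = T.cusp k b ∧ T.cusp k b ≠ T.cusp k c ∧
    T.IsMaximalTree G ∧ T.oneCell k b c hbc ∈ G ∧
    S = T.facePoints n k a b c (fun x y _ => x = 1 ∧ 1 ≤ y) ∪ T.edgePoints n G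

/-- Tree with 3-cycle: for a face whose vertices `a`, `b`, `c` lie at three distinct cusps, and a
maximal tree `G` containing the edges `ab` and `bc` of the face, the points `(j, n-1-j, 1)`,
`1 ≤ j ≤ n-1`, of the face together with the edge points on `G`. -/
def IsThreeCycleFamily (S : Set (T.IntegralPoint n)) : Prop :=
  ∃ (k : K) (a b c : Fin 4) (G : Set T.OneCell) (hab : a ≠ b) (hbc : b ≠ c) (_ : a ≠ c),
    T.cusp k a ≠ T.cusp k b ∧ T.cusp k b ≠ T.cusp k c ∧ T.cusp k a ≠ T.cusp k c ∧
    T.IsMaximalTree G ∧ T.oneCell k a b hab ∈ G ∧ T.oneCell k b c hbc ∈ G ∧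
    S = T.facePoints n k a b c (fun x _ z => 1 ≤ x ∧ z = 1) ∪ T.edgePoints n G

/-- Some 1-cell joins a cusp to itself. -/
def HasSelfEdge : Prop := ∃ e : T.OneCell, (T.ends e).IsDiag

/-! ### The Ptolemy variety and the diagonal action -/

/-- The difference of the two sides of the Ptolemy relation of simplex `k` at `a`, evaluated at
coordinates `c` in a commutative ring. -/
def ptolemyExpr {n : ℕ} {R : Type*} [CommRing R] (c : T.LabelledPoint n → R) (k : K)
    (a : Fin 4 → ℕ) (ha : ∑ i, a i + 2 = n) : R :=
  c (k, .addEdge a ha 0 3 (by decide)) * c (k, .addEdge a ha 1 2 (by decide)) +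
    c (k, .addEdge a ha 0 1 (by decide)) * c (k, .addEdge a ha 2 3 (by decide)) -
    c (k, .addEdge a ha 0 2 (by decide)) * c (k, .addEdge a ha 1 3 (by decide))

/-- The Ptolemy variety `P_n`, as the set of its points: Ptolemy assignments. -/
def ptolemyVariety : Set (T.LabelledPoint n → ℂ) :=
  {c | (∀ p, c p ≠ 0) ∧
    (∀ k a (ha : ∑ i, a i + 2 = n), T.ptolemyExpr c k a ha = 0) ∧
    ∀ p i, p.2.1 i = 0 → c p = blockSign (T.perm p.1 i) p.2.1 * c (T.glue p i)}

/-- The torus `D^v = (ℂˣ)^{v(n-1)}`; `(a₁, …, a_{n-1})` corresponds to the diagonal matrix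
`diag(a₁, a₂/a₁, …, a_{n-1}/a_{n-2}, 1/a_{n-1})`. -/
abbrev Torus : Type _ := T.Cusp → Fin (n - 1) → ℂˣ

/-- The character of the torus by which it scales the Ptolemy coordinate at `(k, t)`: the
coordinates of the torus raised to the coefficients of `∑ᵢ xᵢ ⊗ e_{tᵢ}`. -/
def character {n : ℕ} (x : T.Torus n) (p : T.LabelledPoint n) : ℂˣ :=
  ∏ i, ∏ j, x (T.cusp p.1 i) j ^ unitVec n (p.2.1 i) j

theorem character_one {n : ℕ} (p : T.LabelledPoint n) : T.character 1 p = 1 := by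
  simp [character]

theorem character_mul {n : ℕ} (x y : T.Torus n) (p : T.LabelledPoint n) :
    T.character (x * y) p = T.character x p * T.character y p := by
  simp [character, mul_zpow, Finset.prod_mul_distrib]

theorem character_glue {n : ℕ} (x : T.Torus n) (p : T.LabelledPoint n) (i : Fin 4)
    (h : p.2.1 i = 0) : T.character x (T.glue p i) = T.character x p := by
  unfold character glue SimplexPoint.permute
  rw [← Equiv.prod_comp (T.perm p.1 i)]
  refine Finset.prod_congr rfl fun j _ => ?_
  simp only [Equiv.symm_apply_apply]
  by_cases hj : i = j
  · subst hj
    simp [h, unitVec_zero]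
  · rw [cusp_glue T _ hj]

/-- The common weight of the three terms of a Ptolemy relation. -/
def ptolemyCharacter {n : ℕ} (x : T.Torus n) (k : K) (a : Fin 4 → ℕ) : ℂˣ :=
  ∏ i, ((∏ j, x (T.cusp k i) j ^ unitVec n (a i) j) *
    ∏ j, x (T.cusp k i) j ^ unitVec n (a i + 1) j)

theorem character_addEdge {n : ℕ} (x : T.Torus n) (k : K) (a : Fin 4 → ℕ)
    (ha : ∑ i, a i + 2 = n) (i j l m : Fin 4) (hij : i ≠ j) (hlm : l ≠ m)
    (h : i ≠ l ∧ i ≠ m ∧ j ≠ l ∧ j ≠ m) :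
    T.character x (k, .addEdge a ha i j hij) * T.character x (k, .addEdge a ha l m hlm) =
      T.ptolemyCharacter x k a := by
  unfold character ptolemyCharacter SimplexPoint.addEdge
  rw [← Finset.prod_mul_distrib]
  refine Finset.prod_congr rfl fun r _ => ?_
  have hr : r = i ∨ r = j ∨ r = l ∨ r = m := by
    revert i j l m r
    decide
  obtain ⟨h1, h2, h3, h4⟩ := h
  rcases hr with rfl | rfl | rfl | rfl
  · simp [hij, h1, h2, mul_comm]
  · simp [hij.symm, h3, h4, mul_comm]
  · simp [h1.symm, h3.symm, hlm]
  · simp [h2.symm, h4.symm, hlm.symm]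

/-- Rescaling all coordinates by a torus element rescales each Ptolemy relation. -/
theorem ptolemyExpr_character {n : ℕ} {R : Type*} [CommRing R] [Algebra ℂ R] (x : T.Torus n)
    (c : T.LabelledPoint n → R) (k : K) (a : Fin 4 → ℕ) (ha : ∑ i, a i + 2 = n) :
    T.ptolemyExpr (fun p => algebraMap ℂ R (T.character x p) * c p) k a ha =
      algebraMap ℂ R (T.ptolemyCharacter x k a) * T.ptolemyExpr c k a ha := by
  have h1 := T.character_addEdge x k a ha 0 3 1 2 (by decide) (by decide) (by decide)
  have h2 := T.character_addEdge x k a ha 0 1 2 3 (by decide) (by decide) (by decide)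
  have h3 := T.character_addEdge x k a ha 0 2 1 3 (by decide) (by decide) (by decide)
  replace h1 := congrArg (fun u : ℂˣ => algebraMap ℂ R u) h1
  replace h2 := congrArg (fun u : ℂˣ => algebraMap ℂ R u) h2
  replace h3 := congrArg (fun u : ℂˣ => algebraMap ℂ R u) h3
  simp only [Units.val_mul, map_mul] at h1 h2 h3
  unfold ptolemyExpr
  linear_combination
    (c (k, .addEdge a ha 0 3 (by decide)) * c (k, .addEdge a ha 1 2 (by decide))) * h1 +
    (c (k, .addEdge a ha 0 1 (by decide)) * c (k, .addEdge a ha 2 3 (by decide))) * h2 -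
    (c (k, .addEdge a ha 0 2 (by decide)) * c (k, .addEdge a ha 1 3 (by decide))) * h3

/-- The diagonal action on the Ptolemy variety. -/
noncomputable instance : MulAction (T.Torus n) (T.ptolemyVariety n) where
  smul x c := ⟨fun p => (T.character x p : ℂ) * c.1 p, by
    obtain ⟨h1, h2, h3⟩ := c.2
    refine ⟨fun p => mul_ne_zero (Units.ne_zero _) (h1 p), fun k a ha => ?_, fun p i hp => ?_⟩
    · have := T.ptolemyExpr_character x c.1 k a ha
      simp only [Algebra.algebraMap_self, RingHom.id_apply] at this
      rw [this, h2, mul_zero]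
    · change (T.character x p : ℂ) * c.1 p =
        blockSign (T.perm p.1 i) p.2.1 * ((T.character x (T.glue p i) : ℂ) * c.1 (T.glue p i))
      rw [T.character_glue x p i hp, h3 p i hp]
      ring⟩
  one_smul c := Subtype.ext (funext fun p => by
    change ((T.character 1 p : ℂˣ) : ℂ) * c.1 p = c.1 p
    simp [character_one])
  mul_smul x y c := Subtype.ext (funext fun p => by
    change ((T.character (x * y) p : ℂˣ) : ℂ) * c.1 p =
      (T.character x p : ℂ) * ((T.character y p : ℂ) * c.1 p)
    rw [character_mul, Units.val_mul, mul_assoc])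

/-- The points of the reduced Ptolemy variety `P_n / T`. -/
abbrev ReducedPtolemyVariety : Type _ :=
  MulAction.orbitRel.Quotient (T.Torus n) (T.ptolemyVariety n)

/-- The Ptolemy assignments with coordinate `1` at the points of `S`, where `rep` selects a
representative `(k, t)` of each integral point. -/
def slice {n : ℕ} (rep : T.IntegralPoint n → T.LabelledPoint n) (S : Set (T.IntegralPoint n)) :
    Set (T.LabelledPoint n → ℂ) :=
  {c | c ∈ T.ptolemyVariety n ∧ ∀ P ∈ S, c (rep P) = 1}

/-- The ring of regular functions on a closed subset `V` of `P_n`: the functions generated by the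
Ptolemy coordinates and their inverses. -/
def regularFunctions {n : ℕ} (V : Set (T.LabelledPoint n → ℂ)) : Subalgebra ℂ (V → ℂ) :=
  Algebra.adjoin ℂ ((Set.range fun p (c : V) => c.1 p) ∪ Set.range fun p (c : V) => (c.1 p)⁻¹)

/-- The regular functions on `P_n` that are invariant under the diagonal action. -/
def invariantFunctions : Set (T.ptolemyVariety n → ℂ) :=
  {f | f ∈ T.regularFunctions (T.ptolemyVariety n) ∧
    ∀ (x : T.Torus n) (c : T.ptolemyVariety n), f (x • c) = f c}

/-! ### The coordinate ring by generators and relations -/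

/-- Polynomials in the Ptolemy coordinates (`inl`) and dummy variables (`inr`), which will be the
inverses of the Ptolemy coordinates. -/
abbrev PolyRing : Type _ := MvPolynomial (T.LabelledPoint n ⊕ T.LabelledPoint n) ℂ

/-- The Ptolemy relations, the identification relations, and the invertibility of the Ptolemy
coordinates. -/
def relations : Set (T.PolyRing n) :=
  {f | (∃ k a, ∃ ha : ∑ i, a i + 2 = n,
        f = T.ptolemyExpr (fun p => MvPolynomial.X (Sum.inl p)) k a ha) ∨
     (∃ p i, p.2.1 i = 0 ∧
        f = MvPolynomial.X (Sum.inl p) -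
          MvPolynomial.C (blockSign (T.perm p.1 i) p.2.1) *
            MvPolynomial.X (Sum.inl (T.glue p i))) ∨
     (∃ p, f = MvPolynomial.X (Sum.inl p) * MvPolynomial.X (Sum.inr p) - 1)}

/-- The ideal generated by the relations. -/
noncomputable def relationIdeal : Ideal (T.PolyRing n) := Ideal.span (T.relations n)

/-- The coordinate ring `𝒪` of the Ptolemy variety. -/
abbrev CoordRing : Type _ := T.PolyRing n ⧸ T.relationIdeal n

/-- The diagonal action on polynomials. -/
noncomputable def polyAct {n : ℕ} (x : T.Torus n) : T.PolyRing n →ₐ[ℂ] T.PolyRing n :=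
  MvPolynomial.aeval (Sum.elim
    (fun p => MvPolynomial.C (T.character x p : ℂ) * MvPolynomial.X (Sum.inl p))
    (fun p => MvPolynomial.C ((T.character x p)⁻¹ : ℂˣ).1 * MvPolynomial.X (Sum.inr p)))

theorem relationIdeal_le_comap {n : ℕ} (x : T.Torus n) :
    T.relationIdeal n ≤ (T.relationIdeal n).comap (T.polyAct x) := by
  unfold relationIdeal
  rw [Ideal.span_le]
  rintro f hf
  have hmem := Ideal.subset_span hf
  rcases hf with ⟨k, a, ha, rfl⟩ | ⟨p, i, hp, rfl⟩ | ⟨p, rfl⟩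
  · have h := T.ptolemyExpr_character (R := T.PolyRing n) x
      (fun p => MvPolynomial.X (Sum.inl p)) k a ha
    have : T.polyAct x (T.ptolemyExpr (fun p => MvPolynomial.X (Sum.inl p)) k a ha) =
        T.ptolemyExpr (fun p => algebraMap ℂ (T.PolyRing n) (T.character x p) *
          MvPolynomial.X (Sum.inl p)) k a ha := by
      simp [ptolemyExpr, polyAct, MvPolynomial.algebraMap_eq]
    rw [SetLike.mem_coe, Ideal.mem_comap, this, h]
    exact Ideal.mul_mem_left _ _ hmem
  · rw [SetLike.mem_coe, Ideal.mem_comap]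
    convert Ideal.mul_mem_left _ (MvPolynomial.C (T.character x p : ℂ)) hmem using 1
    simp only [polyAct, map_sub, map_mul, MvPolynomial.aeval_X, Sum.elim_inl,
      MvPolynomial.algHom_C, MvPolynomial.algebraMap_eq, T.character_glue x p i hp]
    ring
  · rw [SetLike.mem_coe, Ideal.mem_comap]
    have hc : (MvPolynomial.C (T.character x p : ℂ) : T.PolyRing n) *
        MvPolynomial.C ((T.character x p)⁻¹ : ℂˣ).1 = 1 := by
      rw [← MvPolynomial.C_mul, Units.mul_inv, MvPolynomial.C_1]
    have key : T.polyAct x (MvPolynomial.X (Sum.inl p) * MvPolynomial.X (Sum.inr p) - 1) =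
        MvPolynomial.X (Sum.inl p) * MvPolynomial.X (Sum.inr p) - 1 := by
      simp only [polyAct, map_sub, map_mul, map_one, MvPolynomial.aeval_X, Sum.elim_inl,
        Sum.elim_inr]
      linear_combination (MvPolynomial.X (Sum.inl p) * MvPolynomial.X (Sum.inr p)) * hc
    rw [key]
    exact hmem

/-- The diagonal action on the coordinate ring. -/
noncomputable def coordAct {n : ℕ} (x : T.Torus n) : T.CoordRing n →ₐ[ℂ] T.CoordRing n :=
  Ideal.quotientMapₐ (T.relationIdeal n) (T.polyAct x) (T.relationIdeal_le_comap x)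

/-- The ring of invariants `𝒪^T`. -/
noncomputable def invariantRing : Subalgebra ℂ (T.CoordRing n) :=
  ⨅ x : T.Torus n, AlgHom.equalizer (T.coordAct x) (AlgHom.id ℂ (T.CoordRing n))

/-- The ideal of `𝒪` generated by the elements `c_P - 1`, `P ∈ S`. -/
noncomputable def sliceIdeal {n : ℕ} (rep : T.IntegralPoint n → T.LabelledPoint n)
    (S : Set (T.IntegralPoint n)) : Ideal (T.CoordRing n) :=
  Ideal.span ((fun P => Ideal.Quotient.mk (T.relationIdeal n)
    (MvPolynomial.X (Sum.inl (rep P))) - 1) '' S)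

end IdealTriangulation

/-! Everything rests on the degree `x ⊗ e_m ↦ m`. The coordinates of an integral point sum to `n`,
so the image of `α*` lies in the kernel of degree mod `n`, a sublattice of index `n` and full rank
`v(n-1)`. If at most `v(n-1)` points have weights generating this kernel, then their weights are a
basis of it: the determinant is `±` the index, and their span maps isomorphically onto the image of
`α*` (`columnsHaveDet_and_isBasicGenerators`).

Generation is checked modulo the weights of the set (`span_weight_eq_ker`). Let `h m` be the class
of `x₀ ⊗ e_m` at a suitable cusp. Subtracting a face relation from an edge relation gives `h (j+1) =
h j + h 1`, and one more point gives `h (n-1) + h 1 = 0`; so `h m = m • h 1` with `n • h 1 = 0`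
(`eq_smul_of_step`). The edges of a maximal tree carry these values to all cusps
(`genMod_eq_smul_of_spans`).

For the reduced variety, basic generators `S` give a projection `q` of `C₁ⁿ` onto `Span(S)` along
the kernel of `α*`. On points, the torus is `Hom(C₀ⁿ, ℂˣ)`. Since `ℂˣ` is divisible, the coordinates
on `S` can be normalized to `1`, and a torus element acting trivially on these acts trivially on all
coordinates. On rings, dividing `c_p` by the Laurent monomial with exponent `q(p)` defines an
endomorphism `ρ` of `𝒪` (`exists_coordProj`). It has invariant values, fixes the invariants, kills
`c_P - 1` for `P ∈ S`, and is the identity modulo these elements. Hence `𝒪` is the direct sum of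
`𝒪^T` and the slice ideal. -/

namespace IdealTriangulation

/-! ### The degree on `C₀ⁿ` and the lattice of weights of degree divisible by `n`. -/

section Weights

variable {K : Type*} (T : IdealTriangulation K) (n : ℕ)

/-- The element `x ⊗ e_m` of `C₀ⁿ`, where `e_0 = 0`. -/
noncomputable def gen (x : T.Cusp) (m : ℕ) : T.C0 n := Finsupp.single x 1 ⊗ₜ[ℤ] unitVec n m

theorem gen_zero (x : T.Cusp) : T.gen n x 0 = 0 := by simp [gen, unitVec_zero]

theorem basisC0_apply (r : T.Cusp × Fin (n - 1)) : T.basisC0 n r = T.gen n r.1 (r.2 + 1) := by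
  have : unitVec n (r.2 + 1) = Pi.single r.2 1 := by
    funext j
    simp [unitVec, Pi.single_apply, Fin.ext_iff]
  rw [gen, this]
  refine (Module.Basis.tensorProduct_apply' _ _ r).trans ?_
  simp

theorem weight_toIntegralPoint (p : T.LabelledPoint n) :
    T.weight (T.toIntegralPoint p) = ∑ i, T.gen n (T.cusp p.1 i) (p.2.1 i) := rfl

theorem alphaStar_single (P : T.IntegralPoint n) :
    T.alphaStar n (Finsupp.single P 1) = T.weight P := by
  simp [alphaStar]

/-- The homomorphism `C₀ⁿ → ℤ` with `x ⊗ e_m ↦ m`. -/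
noncomputable def degree : T.C0 n →ₗ[ℤ] ℤ :=
  (T.basisC0 n).constr ℤ fun r => (r.2 : ℤ) + 1

theorem degree_gen (x : T.Cusp) {m : ℕ} (h : m < n) : T.degree n (T.gen n x m) = m := by
  obtain _ | m := m
  · simp [gen_zero]
  · have := T.basisC0_apply n (x, ⟨m, by omega⟩)
    simp only at this
    rw [← this, degree, Module.Basis.constr_basis]
    simp

theorem coord_lt {n : ℕ} (t : SimplexPoint n) (i : Fin 4) : t.1 i < n := by
  have h1 : t.1 i ≤ ∑ i, t.1 i := Finset.single_le_sum (fun _ _ => Nat.zero_le _)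
    (Finset.mem_univ i)
  have h2 := t.2.1
  have h3 := t.2.2 i
  omega

/-- Excluding the vertices matters: all coordinates are below `n`, whereas `e_n` would vanish in
`ℤ^{n-1}` and lose its degree. -/
theorem degree_weight (P : T.IntegralPoint n) : T.degree n (T.weight P) = n := by
  obtain ⟨p, rfl⟩ := Quot.exists_rep P
  change T.degree n (T.weight (T.toIntegralPoint p)) = n
  rw [weight_toIntegralPoint, map_sum,
    Finset.sum_congr rfl fun i _ => T.degree_gen n _ (coord_lt p.2 i)]
  exact_mod_cast p.2.2.1

/-- The homomorphism `C₀ⁿ → ℤ/n` with `x ⊗ e_m ↦ m`. -/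
noncomputable def degreeMod : T.C0 n →ₗ[ℤ] ZMod n :=
  (Algebra.linearMap ℤ (ZMod n)) ∘ₗ T.degree n

theorem degreeMod_weight (P : T.IntegralPoint n) : T.degreeMod n (T.weight P) = 0 := by
  simp [degreeMod, degree_weight]

instance [Finite K] : Finite (T.IntegralPoint n) := by
  have : Finite (SimplexPoint n) := by
    refine Finite.of_injective (β := Fin 4 → Fin n) (fun t i => ⟨t.1 i, coord_lt t i⟩) ?_
    intro s t h
    ext i
    simpa using congrFun h i
  exact Quot.finite _

/-- If `S` has at most `v(n-1)` elements, and modulo the weights of `S` each `x ⊗ e_m` is `m` times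
one `n`-torsion element, then the weights of `S` generate the kernel of `degreeMod`. -/
theorem span_weight_eq_ker (S : Set (T.IntegralPoint n))
    (a : T.C0 n ⧸ Submodule.span ℤ (T.weight '' S)) (hna : n • a = 0)
    (h : ∀ x m, 0 < m → m < n → Submodule.Quotient.mk (T.gen n x m) = m • a) :
    Submodule.span ℤ (T.weight '' S) = LinearMap.ker (T.degreeMod n) := by
  apply le_antisymm
  · rw [Submodule.span_le]
    rintro _ ⟨P, -, rfl⟩
    exact T.degreeMod_weight n P
  -- On the basis `x ⊗ e_m` the quotient map is `m ↦ m • a`, so it factors through the degree;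
  -- degrees divisible by `n` are then killed because `n • a = 0`.
  · have key : (Submodule.span ℤ (T.weight '' S)).mkQ =
        (LinearMap.toSpanSingleton ℤ _ a) ∘ₗ T.degree n := by
      refine (T.basisC0 n).ext fun r => ?_
      have hr := r.2.2
      rw [basisC0_apply, LinearMap.comp_apply, degree_gen _ _ _ (by omega), Submodule.mkQ_apply,
        h _ _ (by omega) (by omega)]
      rw [LinearMap.toSpanSingleton_apply, natCast_zsmul]
    intro v hv
    have hv' : ((T.degree n v : ℤ) : ZMod n) = 0 := hv
    rw [ZMod.intCast_zmod_eq_zero_iff_dvd] at hv'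
    obtain ⟨d, hd⟩ := hv'
    rw [← Submodule.Quotient.mk_eq_zero, ← Submodule.mkQ_apply, key, LinearMap.comp_apply, hd,
      LinearMap.toSpanSingleton_apply, mul_comm, mul_smul, natCast_zsmul, hna, smul_zero]

theorem card_quotient_ker_degreeMod (hn : 2 ≤ n) (x : T.Cusp) :
    Nat.card (T.C0 n ⧸ LinearMap.ker (T.degreeMod n)) = n := by
  have hs : Function.Surjective (T.degreeMod n) := by
    intro z
    obtain ⟨d, rfl⟩ := ZMod.intCast_surjective z
    refine ⟨d • T.gen n x 1, ?_⟩
    simp [degreeMod, T.degree_gen n x (show 1 < n by omega)]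
  rw [Nat.card_congr ((T.degreeMod n).quotKerEquivOfSurjective hs).toEquiv, Nat.card_zmod]

/-- The kernel contains `n · C₀ⁿ`, and multiplication by `n` is injective on a free group, so the
rank does not drop. -/
theorem finrank_ker_degreeMod [Finite K] (hn : 2 ≤ n) :
    Module.finrank ℤ (LinearMap.ker (T.degreeMod n)) = Nat.card (T.Cusp × Fin (n - 1)) := by
  have : Module.Finite ℤ (T.C0 n) := Module.Finite.of_basis (T.basisC0 n)
  have : Module.Free ℤ (T.C0 n) := Module.Free.of_basis (T.basisC0 n)
  have h0 : Module.finrank ℤ (T.C0 n) = Nat.card (T.Cusp × Fin (n - 1)) := by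
    rw [Module.finrank_eq_nat_card_basis (T.basisC0 n)]
  refine le_antisymm (h0 ▸ Submodule.finrank_le _) ?_
  rw [← h0]
  refine LinearMap.finrank_le_finrank_of_injective
    (f := LinearMap.codRestrict (LinearMap.ker (T.degreeMod n))
      ((n : ℤ) • LinearMap.id) (fun v => by simp)) ?_
  rw [LinearMap.injective_codRestrict_iff]
  intro v w h
  have hn0 : (n : ℤ) ≠ 0 := by omega
  have := (T.basisC0 n).isTorsionFree
  exact smul_right_injective _ hn0 h

open Classical in
/-- A set of at most `v(n-1)` points whose weights generate the kernel of `degreeMod` is a set of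
basic generators, and its columns have determinant `± n`. -/
theorem columnsHaveDet_and_isBasicGenerators [Finite K] (hn : 2 ≤ n) (x : T.Cusp)
    (S : Set (T.IntegralPoint n)) (hS : Nat.card S ≤ Nat.card (T.Cusp × Fin (n - 1)))
    (h : Submodule.span ℤ (T.weight '' S) = LinearMap.ker (T.degreeMod n)) :
    T.ColumnsHaveDet S n ∧ IsBasicGenerators (T.alphaStar n) S := by
  have : Module.Finite ℤ (T.C0 n) := Module.Finite.of_basis (T.basisC0 n)
  have : Module.Free ℤ (T.C0 n) := Module.Free.of_basis (T.basisC0 n)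
  have := Fintype.ofFinite S
  have hr := T.finrank_ker_degreeMod n hn
  -- A generating set of a free group has at least as many elements as the rank. This is why only
  -- upper bounds on the sizes of the families are proved below.
  have hcard : Nat.card S = Nat.card (T.Cusp × Fin (n - 1)) := by
    refine le_antisymm hS ?_
    rw [← hr, ← h, Set.image_eq_range]
    have := finrank_range_le_card (R := ℤ) (fun s : S => T.weight s.1)
    rwa [← Nat.card_eq_fintype_card] at this
  let φ : (S →₀ ℤ) →ₗ[ℤ] T.C0 n := Finsupp.linearCombination ℤ fun s : S => T.weight s.1
  have hφ : LinearMap.range φ = LinearMap.ker (T.degreeMod n) := by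
    rw [← h, Set.image_eq_range, Finsupp.range_linearCombination]
  -- Equal ranks turn `φ` into a surjective endomorphism of a finitely generated module, which must
  -- be injective.
  let f := LinearEquiv.ofFinrankEq (R := ℤ) (LinearMap.range φ) (S →₀ ℤ) (by
      rw [hφ, hr, ← hcard, Module.finrank_finsupp_self, Nat.card_eq_fintype_card])
  have hinj : Function.Injective φ := by
    have := OrzechProperty.injective_of_surjective_endomorphism (f.toLinearMap ∘ₗ φ.rangeRestrict)
      (f.surjective.comp φ.surjective_rangeRestrict)
    rw [LinearMap.coe_comp] at this
    rw [← LinearMap.injective_rangeRestrict_iff]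
    exact this.of_comp
  constructor
  · obtain ⟨e⟩ := (Finite.card_eq.1 hcard.symm)
    refine ⟨e, ?_⟩
    let b : Module.Basis S ℤ (LinearMap.range φ) :=
      Module.Basis.ofRepr (LinearEquiv.ofInjective φ hinj).symm
    have hb : ∀ s, (b s : T.C0 n) = T.weight s.1 := fun s => by simp [b, φ]
    -- The determinant of a basis of a full rank sublattice is, up to sign, its index, here `n`.
    have := Submodule.natAbs_det_basis_change (T.basisC0 n) _ (b.reindex e.symm)
    have hq := T.card_quotient_ker_degreeMod n hn x
    rw [← hφ, ← this] at hq
    refine Eq.trans ?_ (congrArg (Nat.cast : ℕ → ℤ) hq)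
    rw [Int.natCast_natAbs, Module.Basis.det_apply]
    congr 2
    ext r c
    simp [Module.Basis.toMatrix_apply, hb, alphaStar_single]
  · constructor
    · rw [← Finsupp.supported_eq_span_single]
      refine LinearMap.injOn_of_disjoint_ker le_rfl ?_
      exact linearIndepOn_iff_disjoint.1 hinj
    · rw [Submodule.map_span, ← Set.image_comp]
      have : (T.alphaStar n : T.C1 n → T.C0 n) ∘ (fun j => Finsupp.single j (1 : ℤ)) = T.weight :=
        funext fun P => T.alphaStar_single n P
      rw [this]
      refine le_antisymm ?_ ?_
      · rw [alphaStar, Finsupp.range_linearCombination]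
        exact Submodule.span_mono (Set.image_subset_range _ _)
      · rw [h, alphaStar, Finsupp.range_linearCombination, Submodule.span_le]
        rintro _ ⟨P, rfl⟩
        exact T.degreeMod_weight n P

end Weights

/-! ### Spanning trees in the multigraph of 1-cells, and existence of the three families. -/

section MaximalTrees

variable {K : Type*} (T : IdealTriangulation K)

/-- The simple graph on the cusps underlying a set of 1-cells. -/
def cuspGraph (G : Set T.OneCell) : SimpleGraph T.Cusp := SimpleGraph.fromEdgeSet (T.ends '' G)

theorem spans_iff_preconnected (G : Set T.OneCell) :
    T.Spans G ↔ (T.cuspGraph G).Preconnected := by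
  unfold Spans SimpleGraph.Preconnected cuspGraph
  rw [SimpleGraph.reachable_fromEdgeSet_eq_reflTransGen_toRel]
  rfl

theorem ends_oneCell (k : K) (i j : Fin 4) (h : i ≠ j) :
    T.ends (T.oneCell k i j h) = s(T.cusp k i, T.cusp k j) := rfl

instance [Finite K] : Finite T.OneCell := Quot.finite _

theorem card_cusp_le_of_spans [Finite K] [Nonempty T.Cusp] (G : Set T.OneCell) (h : T.Spans G) :
    Nat.card T.Cusp ≤ G.ncard + 1 := by
  rw [spans_iff_preconnected] at h
  refine (SimpleGraph.Connected.mk h).card_vert_le_card_edgeSet_add_one.trans ?_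
  have h1 : (T.cuspGraph G).edgeSet ⊆ T.ends '' G := by
    rw [cuspGraph, SimpleGraph.edgeSet_fromEdgeSet]
    exact Set.sdiff_subset
  have h2 := Set.ncard_le_ncard h1
  have h3 := Set.ncard_image_le (f := T.ends) (Set.toFinite G)
  rw [Nat.card_coe_set_eq]
  omega

/-- A tree inside the graph of a set `G` of 1-cells is the graph of a set of 1-cells in `G`, which
can be chosen to contain given 1-cells lying over different edges of the tree. -/
theorem exists_spans_of_isTree [Finite K] {G G₀ : Set T.OneCell} (h₀ : G₀ ⊆ G)
    (hinj : Set.InjOn T.ends G₀) {F : SimpleGraph T.Cusp} (hF : F.IsTree)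
    (hFG : F ≤ T.cuspGraph G) (hF₀ : ∀ e ∈ G₀, T.ends e ∈ F.edgeSet) :
    ∃ G', G₀ ⊆ G' ∧ G' ⊆ G ∧ T.Spans G' ∧ G'.ncard + 1 ≤ Nat.card T.Cusp := by
  classical
  -- Several 1-cells may lie over one edge of the tree. One is chosen for each edge, the prescribed
  -- one if there is one; injectivity of `ends` on `G₀` makes that choice unambiguous.
  have key : ∀ f : F.edgeSet, ∃ e ∈ G, T.ends e = f ∧ ∀ e' ∈ G₀, T.ends e' = f → e = e' := by
    intro f
    by_cases hf : ∃ e ∈ G₀, T.ends e = f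
    · obtain ⟨e, he, hef⟩ := hf
      exact ⟨e, h₀ he, hef, fun e' he' h => hinj he he' (hef.trans h.symm)⟩
    · have h1 := SimpleGraph.edgeSet_mono hFG f.2
      rw [cuspGraph, SimpleGraph.edgeSet_fromEdgeSet] at h1
      obtain ⟨e, he, hef⟩ := h1.1
      exact ⟨e, he, hef, fun e' he' h => (hf ⟨e', he', h⟩).elim⟩
  choose s hsG hs hs₀ using key
  refine ⟨Set.range s, fun e he => ⟨⟨_, hF₀ e he⟩, hs₀ _ e he rfl⟩, ?_, ?_, ?_⟩
  · rintro _ ⟨f, rfl⟩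
    exact hsG f
  · rw [spans_iff_preconnected]
    refine hF.1.preconnected.mono ?_
    rw [← SimpleGraph.edgeSet_subset_edgeSet, cuspGraph, SimpleGraph.edgeSet_fromEdgeSet]
    intro f hf
    exact ⟨⟨_, ⟨⟨f, hf⟩, rfl⟩, hs ⟨f, hf⟩⟩, F.not_isDiag_of_mem_edgeSet hf⟩
  · have h1 := hF.card_edgeFinset
    have h2 := Set.ncard_image_le (f := s) (Set.toFinite Set.univ)
    rw [Set.image_univ, Set.ncard_univ, Nat.card_eq_fintype_card, ← SimpleGraph.edgeFinset_card]
      at h2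
    rw [Nat.card_eq_fintype_card]
    omega

/-- Lifting a spanning tree of the underlying simple graph gives a spanning `G' ⊆ G` with at most `v
- 1` cells, and minimality forces `G ⊆ G'`. -/
theorem card_add_one_le_of_isMaximalTree [Finite K] [Nonempty T.Cusp] (G : Set T.OneCell)
    (hG : T.IsMaximalTree G) : G.ncard + 1 ≤ Nat.card T.Cusp := by
  obtain ⟨F, hF, hFt⟩ := (SimpleGraph.Connected.mk
    ((T.spans_iff_preconnected G).1 hG.1)).exists_isTree_le
  obtain ⟨G', -, hG', hsp, hcard⟩ := T.exists_spans_of_isTree (Set.empty_subset G)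
    (Set.injOn_empty _) hFt hF (by simp)
  have := Set.ncard_le_ncard (hG.2 hsp hG')
  omega

/-- An acyclic graph extends to a spanning tree; its lift has at most `v - 1` cells, and is minimal
because a connected graph on `v` vertices has at least `v - 1` edges. -/
theorem exists_isMaximalTree [Finite K] [Nonempty T.Cusp] (hT : T.Spans Set.univ)
    (G₀ : Set T.OneCell) (hinj : Set.InjOn T.ends G₀) (hdiag : ∀ e ∈ G₀, ¬ (T.ends e).IsDiag)
    (hac : (T.cuspGraph G₀).IsAcyclic) : ∃ G, T.IsMaximalTree G ∧ G₀ ⊆ G := by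
  obtain ⟨F, hF₀, hF, hFt⟩ := (SimpleGraph.Connected.mk
    ((T.spans_iff_preconnected _).1 hT)).exists_isTree_le_of_le_of_isAcyclic
    (SimpleGraph.fromEdgeSet_mono (Set.image_mono (Set.subset_univ G₀))) hac
  obtain ⟨G', hG₀, hG', hsp, hcard⟩ := T.exists_spans_of_isTree (Set.subset_univ G₀)
    hinj hFt hF (fun e he => by
      apply SimpleGraph.edgeSet_mono hF₀
      rw [SimpleGraph.edgeSet_fromEdgeSet]
      exact ⟨⟨e, he, rfl⟩, hdiag e he⟩)
  refine ⟨G', ⟨hsp, fun G'' hsp'' hle => ?_⟩, hG₀⟩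
  have h1 := T.card_cusp_le_of_spans G'' hsp''
  exact (Set.eq_of_subset_of_ncard_le hle (by omega)).ge

theorem cuspGraph_singleton (e : T.OneCell) {x y : T.Cusp} (h : T.ends e = s(x, y)) :
    T.cuspGraph {e} = SimpleGraph.edge x y := by
  simp [cuspGraph, h, SimpleGraph.edge]

theorem cuspGraph_pair (e f : T.OneCell) {x y z : T.Cusp} (he : T.ends e = s(x, y))
    (hf : T.ends f = s(y, z)) :
    T.cuspGraph {e, f} = SimpleGraph.edge x y ⊔ SimpleGraph.edge y z := by
  rw [cuspGraph, Set.image_pair, he, hf, Set.insert_eq]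
  exact SimpleGraph.fromEdgeSet_union _ _

theorem edge_isAcyclic {V : Type*} (x y : V) : (SimpleGraph.edge x y).IsAcyclic := by
  have := (SimpleGraph.isAcyclic_sup_fromEdgeSet_iff (G := (⊥ : SimpleGraph V)) (u := x)
    (v := y)).2 ⟨SimpleGraph.isAcyclic_bot, fun h => Or.inl (SimpleGraph.reachable_bot.1 h)⟩
  rwa [bot_sup_eq] at this

/-- The vertex `z` is isolated in the graph with single edge `xy`, so `yz` joins two components and
closes no cycle. -/
theorem edge_sup_edge_isAcyclic {V : Type*} {x y z : V} (hxz : x ≠ z) (hyz : y ≠ z) :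
    (SimpleGraph.edge x y ⊔ SimpleGraph.edge y z).IsAcyclic := by
  refine SimpleGraph.isAcyclic_sup_fromEdgeSet_iff.2 ⟨edge_isAcyclic x y, fun h => ?_⟩
  rw [SimpleGraph.reachable_iff_reflTransGen] at h
  obtain h | ⟨w, -, hw⟩ := Relation.ReflTransGen.cases_tail h
  · exact Or.inl h.symm
  · rw [SimpleGraph.edge_adj] at hw
    grind

theorem spans_univ (hT : T.IsConnected) : T.Spans Set.univ := by
  have h1 : ∀ k i j, Relation.ReflTransGen
      (fun a b => ∃ e ∈ (Set.univ : Set T.OneCell), T.ends e = s(a, b))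
      (T.cusp k i) (T.cusp k j) := by
    intro k i j
    by_cases h : i = j
    · rw [h]
    · exact .single ⟨T.oneCell k i j h, trivial, rfl⟩
  have h2 : ∀ k l, Relation.ReflTransGen (fun a b => ∃ i, b = T.nbr a i) k l → ∀ i j,
      Relation.ReflTransGen (fun a b => ∃ e ∈ (Set.univ : Set T.OneCell), T.ends e = s(a, b))
      (T.cusp k i) (T.cusp l j) := by
    intro k l h
    induction h with
    | refl => exact h1 k
    | tail _ h ih =>
      rename_i b c _
      obtain ⟨f, rfl⟩ := h
      intro i j
      -- Any vertex `m ≠ f` lies on the glued face, hence gives the same cusp in both simplices.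
      obtain ⟨m, hm⟩ := exists_ne f
      refine (ih i m).trans ?_
      rw [← T.cusp_glue b hm.symm]
      exact h1 _ _ _
  intro x y
  obtain ⟨⟨k, i⟩, rfl⟩ := Quot.exists_rep x
  obtain ⟨⟨l, j⟩, rfl⟩ := Quot.exists_rep y
  exact h2 k l (hT.2 k l) i j

theorem oneCell_cases (e : T.OneCell) : ∃ k i j, ∃ h : i ≠ j, e = T.oneCell k i j h := by
  obtain ⟨⟨k, ⟨⟨i, j⟩, h⟩⟩, rfl⟩ := Quot.exists_rep e
  exact ⟨k, i, j, h, rfl⟩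

/-- In a triangulation with a self edge and more than one cusp, some face has two vertices at one
cusp and the third at another cusp. -/
theorem exists_face_of_hasSelfEdge (hT : T.IsConnected) (hv : 1 < Nat.card T.Cusp)
    (h : T.HasSelfEdge) : ∃ k a b c, a ≠ b ∧ b ≠ c ∧ a ≠ c ∧ T.cusp k a = T.cusp k b ∧
      T.cusp k b ≠ T.cusp k c := by
  obtain ⟨e, he⟩ := h
  obtain ⟨k, i, j, hij, rfl⟩ := T.oneCell_cases e
  rw [ends_oneCell, Sym2.mk_isDiag_iff] at he
  by_contra hcon
  push Not at hcon
  -- Without a face of the desired kind, two vertices at one cusp force the third vertex of every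
  -- face through them to that cusp, so the simplex with the self edge has a single cusp.
  have h0 : ∀ l, T.cusp k l = T.cusp k i := by
    intro l
    by_cases h1 : j = l
    · rw [← h1, he]
    by_cases h2 : i = l
    · rw [← h2]
    · rw [← hcon k i j l hij h1 h2 he, he]
  have h1 : ∀ l, Relation.ReflTransGen (fun a b => ∃ i, b = T.nbr a i) k l →
      ∀ m, T.cusp l m = T.cusp k i := by
    intro l hl
    induction hl with
    | refl => exact h0
    | tail _ h ih =>
      rename_i b c _
      obtain ⟨f, rfl⟩ := h
      have h3 : ∀ m, m ≠ T.perm b f f → T.cusp (T.nbr b f) m = T.cusp k i := by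
        intro m hm
        obtain ⟨m', rfl⟩ := (T.perm b f).surjective m
        rw [T.cusp_glue b (fun h => hm (by rw [h])), ih]
      intro m
      by_cases hm : m = T.perm b f f
      -- The vertex of the neighbour opposite the shared face forms another face with two vertices
      -- `p`, `q` of the shared face, already known to be at the cusp.
      · obtain ⟨p, q, hp, hq, hpq⟩ : ∃ p q : Fin 4, p ≠ m ∧ q ≠ m ∧ p ≠ q := by
          clear hm
          revert m
          decide
        rw [← hcon _ p q m hpq hq hp (by rw [h3 p (hm ▸ hp), h3 q (hm ▸ hq)]), h3 q (hm ▸ hq)]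
      · exact h3 m hm
  have : Subsingleton T.Cusp := by
    refine ⟨fun x y => ?_⟩
    obtain ⟨⟨l, m⟩, rfl⟩ := Quot.exists_rep x
    obtain ⟨⟨l', m'⟩, rfl⟩ := Quot.exists_rep y
    exact (h1 l (hT.2 k l) m).trans (h1 l' (hT.2 k l') m').symm
  have := Finite.card_le_one_iff_subsingleton.2 this
  omega

theorem cusp_ne_of_not_hasSelfEdge (h : ¬ T.HasSelfEdge) (k : K) {i j : Fin 4} (hij : i ≠ j) :
    T.cusp k i ≠ T.cusp k j := fun he => h ⟨T.oneCell k i j hij, by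
  rw [ends_oneCell, Sym2.mk_isDiag_iff, he]⟩

theorem exists_isOneCycleFamily [Finite K] (n : ℕ) (hT : T.IsConnected)
    (hv : 1 < Nat.card T.Cusp) (h : T.HasSelfEdge) : ∃ S, T.IsOneCycleFamily n S := by
  obtain ⟨k, a, b, c, hab, hbc, hac, h1, h2⟩ := T.exists_face_of_hasSelfEdge hT hv h
  have : Nonempty T.Cusp := ⟨T.cusp k a⟩
  have hends := T.ends_oneCell k b c hbc
  obtain ⟨G, hG, hsub⟩ := T.exists_isMaximalTree (T.spans_univ hT) {T.oneCell k b c hbc}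
    (Set.injOn_singleton _ _) (by simpa [hends] using h2)
    (by rw [T.cuspGraph_singleton _ hends]; exact edge_isAcyclic _ _)
  exact ⟨_, k, a, b, c, G, hab, hbc, hac, h1, h2, hG, hsub rfl, rfl⟩

theorem exists_isThreeCycleFamily [Finite K] (n : ℕ) (hT : T.IsConnected)
    (h : ¬ T.HasSelfEdge) : ∃ S, T.IsThreeCycleFamily n S := by
  obtain ⟨k⟩ := hT.1
  have : Nonempty T.Cusp := ⟨T.cusp k 0⟩
  have h01 := T.cusp_ne_of_not_hasSelfEdge h k (i := 0) (j := 1) (by decide)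
  have h12 := T.cusp_ne_of_not_hasSelfEdge h k (i := 1) (j := 2) (by decide)
  have h02 := T.cusp_ne_of_not_hasSelfEdge h k (i := 0) (j := 2) (by decide)
  have e1 := T.ends_oneCell k 0 1 (by decide)
  have e2 := T.ends_oneCell k 1 2 (by decide)
  obtain ⟨G, hG, hsub⟩ := T.exists_isMaximalTree (T.spans_univ hT)
    {T.oneCell k 0 1 (by decide), T.oneCell k 1 2 (by decide)}
    (by
      rw [Set.injOn_pair]
      intro he
      rw [e1, e2, Sym2.eq_iff] at he
      grind)
    (by
      intro e he
      obtain rfl | rfl := he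
      · rwa [e1, Sym2.mk_isDiag_iff]
      · rwa [e2, Sym2.mk_isDiag_iff])
    (by rw [T.cuspGraph_pair _ _ e1 e2]; exact edge_sup_edge_isAcyclic h02 h12)
  exact ⟨_, k, 0, 1, 2, G, by decide, by decide, by decide, h01, h12, h02, hG,
    hsub (Or.inl rfl), hsub (Or.inr rfl), rfl⟩

theorem exists_isOneCuspFamily (n : ℕ) (hT : T.IsConnected) : ∃ S, T.IsOneCuspFamily n S := by
  obtain ⟨k⟩ := hT.1
  exact ⟨_, k, 0, 1, 2, by decide, by decide, by decide, rfl⟩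

end MaximalTrees

/-! ### The three families of integral points: relations, counting, determinants. -/

section Families

variable {K : Type*} (T : IdealTriangulation K) (n : ℕ)

/-! ### Relations between the generators modulo the weights of a set of integral points -/

theorem exists_fourth (a b c : Fin 4) : ∃ d, d ≠ a ∧ d ≠ b ∧ d ≠ c := by
  revert a b c
  decide

theorem univ_fin_four {a b c d : Fin 4} (hab : a ≠ b) (hbc : b ≠ c) (hac : a ≠ c) (hda : d ≠ a)
    (hdb : d ≠ b) (hdc : d ≠ c) : (Finset.univ : Finset (Fin 4)) = {a, b, c, d} := by
  revert a b c d
  decide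

theorem sum_fin_four {M : Type*} [AddCommMonoid M] {a b c d : Fin 4} (hab : a ≠ b) (hbc : b ≠ c)
    (hac : a ≠ c) (hda : d ≠ a) (hdb : d ≠ b) (hdc : d ≠ c) (f : Fin 4 → M) :
    ∑ i, f i = f a + f b + f c + f d := by
  rw [univ_fin_four hab hbc hac hda hdb hdc, Finset.sum_insert (by simp [hab, hac, hda.symm]),
    Finset.sum_insert (by simp [hbc, hdb.symm]), Finset.sum_pair hdc.symm]
  simp only [add_assoc]

theorem exists_simplexPoint {n : ℕ} {a b c : Fin 4} (hab : a ≠ b) (hbc : b ≠ c) (hac : a ≠ c)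
    {x y z : ℕ} (hx : x < n) (hy : y < n) (hz : z < n) (h : x + y + z = n) :
    ∃ t : SimplexPoint n, t.1 a = x ∧ t.1 b = y ∧ t.1 c = z := by
  refine ⟨⟨fun l => if l = a then x else if l = b then y else if l = c then z else 0, ?_, ?_⟩,
    by simp, by simp [hab.symm], by simp [hbc.symm, hac.symm]⟩
  · obtain ⟨d, hda, hdb, hdc⟩ := exists_fourth a b c
    rw [sum_fin_four hab hbc hac hda hdb hdc]
    simp [hab.symm, hbc.symm, hac.symm, hda, hdb, hdc, h]
  · intro l
    dsimp only
    split_ifs <;> omega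

theorem weight_face (k : K) {a b c : Fin 4} (hab : a ≠ b) (hbc : b ≠ c) (hac : a ≠ c)
    (t : SimplexPoint n) (h : t.1 a + t.1 b + t.1 c = n) :
    T.weight (T.toIntegralPoint (k, t)) = T.gen n (T.cusp k a) (t.1 a) +
      T.gen n (T.cusp k b) (t.1 b) + T.gen n (T.cusp k c) (t.1 c) := by
  obtain ⟨d, hda, hdb, hdc⟩ := exists_fourth a b c
  have h1 := sum_fin_four hab hbc hac hda hdb hdc t.1
  have h2 := t.2.1
  have h3 : t.1 d = 0 := by omega
  rw [weight_toIntegralPoint, sum_fin_four hab hbc hac hda hdb hdc]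
  simp only [h3, gen_zero, add_zero]

variable {n}

/-- The class of `x ⊗ e_m` modulo the weights of `S`. -/
noncomputable def genMod (S : Set (T.IntegralPoint n)) (x : T.Cusp) (m : ℕ) :
    T.C0 n ⧸ Submodule.span ℤ (T.weight '' S) :=
  Submodule.Quotient.mk (T.gen n x m)

theorem genMod_zero (S : Set (T.IntegralPoint n)) (x : T.Cusp) : T.genMod S x 0 = 0 := by
  rw [genMod, gen_zero, Submodule.Quotient.mk_zero]

theorem genMod_face {S : Set (T.IntegralPoint n)} {k : K} {a b c : Fin 4} (hab : a ≠ b)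
    (hbc : b ≠ c) (hac : a ≠ c) {Q : ℕ → ℕ → ℕ → Prop} (hS : T.facePoints n k a b c Q ⊆ S)
    {x y z : ℕ} (hx : x < n) (hy : y < n) (hz : z < n) (h : x + y + z = n) (hQ : Q x y z) :
    T.genMod S (T.cusp k a) x + T.genMod S (T.cusp k b) y + T.genMod S (T.cusp k c) z = 0 := by
  obtain ⟨t, rfl, rfl, rfl⟩ := exists_simplexPoint hab hbc hac hx hy hz h
  have hmem := hS ⟨t, rfl, h, hQ⟩
  unfold genMod
  rw [← Submodule.Quotient.mk_add, ← Submodule.Quotient.mk_add, ← T.weight_face n k hab hbc hac t h,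
    Submodule.Quotient.mk_eq_zero]
  exact Submodule.subset_span ⟨_, hmem, rfl⟩

theorem genMod_edge {S : Set (T.IntegralPoint n)} {G : Set T.OneCell}
    (hS : T.edgePoints n G ⊆ S) {e : T.OneCell} (he : e ∈ G) {x y : T.Cusp}
    (hxy : T.ends e = s(x, y)) {m : ℕ} (h0 : 0 < m) (hm : m < n) :
    T.genMod S x m + T.genMod S y (n - m) = 0 := by
  obtain ⟨k, i, j, hij, rfl⟩ := T.oneCell_cases e
  obtain ⟨l, hjl, hil⟩ : ∃ l : Fin 4, j ≠ l ∧ i ≠ l := by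
    clear hxy he
    revert i j
    decide
  have key : ∀ m', 0 < m' → m' < n →
      T.genMod S (T.cusp k i) m' + T.genMod S (T.cusp k j) (n - m') = 0 := by
    intro m' h0' hm'
    -- An edge point is a face point with third coordinate `0`, whose contribution vanishes since
    -- `e_0 = 0`.
    have := T.genMod_face (S := S) (k := k) hij hjl hil (Q := fun _ _ z => z = 0) (by
      rintro _ ⟨t, rfl, h1, h2⟩
      exact hS ⟨(k, t), i, j, hij, rfl, by simpa [h2] using h1, he⟩) hm'
      (show n - m' < n by omega) (show 0 < n by omega) (by omega) rfl
    rwa [genMod_zero, add_zero] at this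
  rw [ends_oneCell, Sym2.eq_iff] at hxy
  obtain ⟨rfl, rfl⟩ | ⟨rfl, rfl⟩ := hxy
  · exact key m h0 hm
  · have := key (n - m) (by omega) (by omega)
    rwa [add_comm, show n - (n - m) = m by omega] at this

/-- Crossing a 1-cell of `G` replaces `e_m` at one end by `-e_{n-m}` at the other, and `-(n-m) • a =
m • a` because `n • a = 0`. -/
theorem genMod_eq_smul_of_spans {S : Set (T.IntegralPoint n)} {G : Set T.OneCell}
    (hS : T.edgePoints n G ⊆ S) (hG : T.Spans G) {a : T.C0 n ⧸ Submodule.span ℤ (T.weight '' S)}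
    (ha : n • a = 0) (x₀ : T.Cusp) (h : ∀ m, 0 < m → m < n → T.genMod S x₀ m = m • a)
    (x : T.Cusp) : ∀ m, 0 < m → m < n → T.genMod S x m = m • a := by
  induction hG x₀ x with
  | refl => exact h
  | tail _ hbc ih =>
    obtain ⟨e, he, hends⟩ := hbc
    intro m h0 hm
    have h1 := T.genMod_edge hS he hends (m := n - m) (by omega) (by omega)
    rw [show n - (n - m) = m by omega, ih _ (by omega) (by omega)] at h1
    have h2 : (n - m) • a + m • a = 0 := by
      rw [← add_smul, show n - m + m = n by omega, ha]
    exact add_left_cancel (h1.trans h2.symm)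

/-- The common arithmetic core of the three families: the step relation makes `h` linear, and the
closing relation `hl` then becomes `n • h 1 = 0`. -/
theorem eq_smul_of_step {M : Type*} [AddCommGroup M] {n : ℕ} (hn : 2 ≤ n) (h : ℕ → M)
    (hs : ∀ j, 0 < j → j + 1 < n → h (j + 1) = h j + h 1) (hl : h (n - 1) + h 1 = 0) :
    n • h 1 = 0 ∧ ∀ m, 0 < m → m < n → h m = m • h 1 := by
  have key : ∀ m, 0 < m → m < n → h m = m • h 1 := by
    intro m h0
    induction m, h0 using Nat.le_induction with
    | base => simp
    | succ m h0 ih =>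
      intro hm
      rw [hs m h0 hm, ih (by omega), succ_nsmul]
  refine ⟨?_, key⟩
  rw [key _ (by omega) (by omega), ← succ_nsmul] at hl
  rwa [show n - 1 + 1 = n by omega] at hl

/-! ### Counting -/

theorem ncard_simplex_image_le [Finite K] (k : K) (U : Set (SimplexPoint n))
    (v : SimplexPoint n → ℕ) (hv : ∀ t ∈ U, v t < n - 1) (hinj : Set.InjOn v U) :
    ((fun t => T.toIntegralPoint (k, t)) '' U).ncard ≤ n - 1 := by
  have hf : U.Finite := Set.Finite.of_finite_image (Set.Finite.subset (Set.finite_Iio (n - 1))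
    (by rintro _ ⟨t, ht, rfl⟩; exact hv t ht)) hinj
  refine (Set.ncard_image_le hf).trans ?_
  have := Set.ncard_le_ncard_of_injOn (t := Set.Iio (n - 1)) v hv hinj
  rwa [Set.ncard_Iio_nat] at this

theorem simplexPoint_ext {a b c : Fin 4} (hab : a ≠ b) (hbc : b ≠ c) (hac : a ≠ c)
    {s t : SimplexPoint n} (hs : s.1 a + s.1 b + s.1 c = n) (ht : t.1 a + t.1 b + t.1 c = n)
    (ha : s.1 a = t.1 a) (hb : s.1 b = t.1 b) : s = t := by
  obtain ⟨d, hda, hdb, hdc⟩ := exists_fourth a b c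
  have h1 := sum_fin_four hab hbc hac hda hdb hdc s.1
  have h2 := sum_fin_four hab hbc hac hda hdb hdc t.1
  have h3 := s.2.1
  have h4 := t.2.1
  ext i
  have hi := Finset.mem_univ i
  rw [univ_fin_four hab hbc hac hda hdb hdc] at hi
  simp only [Finset.mem_insert, Finset.mem_singleton] at hi
  obtain rfl | rfl | rfl | rfl := hi <;> omega

/-- Each family supplies a numbering `v` of its points by the values `0, …, n-2`. -/
theorem ncard_facePoints_le [Finite K] (k : K) {a b c : Fin 4} (hab : a ≠ b) (hbc : b ≠ c)
    (hac : a ≠ c) (Q : ℕ → ℕ → ℕ → Prop) (v : ℕ → ℕ → ℕ → ℕ)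
    (hv : ∀ x y z, x < n → y < n → z < n → x + y + z = n → Q x y z → v x y z < n - 1)
    (hinj : ∀ x y z x' y' z', x < n → y < n → z < n → x' < n → y' < n → z' < n →
      x + y + z = n → x' + y' + z' = n → Q x y z → Q x' y' z' → v x y z = v x' y' z' →
      x = x' ∧ y = y') :
    (T.facePoints n k a b c Q).ncard ≤ n - 1 := by
  have : T.facePoints n k a b c Q = (fun t => T.toIntegralPoint (k, t)) ''
      {t : SimplexPoint n | t.1 a + t.1 b + t.1 c = n ∧ Q (t.1 a) (t.1 b) (t.1 c)} := by
    ext P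
    constructor
    · rintro ⟨t, h1, h2⟩
      exact ⟨t, h2, h1⟩
    · rintro ⟨t, h2, h1⟩
      exact ⟨t, h1, h2⟩
  rw [this]
  refine T.ncard_simplex_image_le k _ (fun t => v (t.1 a) (t.1 b) (t.1 c)) ?_ ?_
  · rintro t ⟨h1, h2⟩
    exact hv _ _ _ (coord_lt t a) (coord_lt t b) (coord_lt t c) h1 h2
  · rintro s ⟨h1, h2⟩ t ⟨h3, h4⟩ h
    obtain ⟨h5, h6⟩ := hinj _ _ _ _ _ _ (coord_lt s a) (coord_lt s b) (coord_lt s c)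
      (coord_lt t a) (coord_lt t b) (coord_lt t c) h1 h3 h2 h4 h
    exact simplexPoint_ext hab hbc hac h1 h3 h5 h6

variable (n) in
/-- The integral points on a 1-cell. -/
def cellPoints : T.OneCell → Set (T.IntegralPoint n) :=
  Quot.lift (fun a => {P | ∃ t : SimplexPoint n, T.toIntegralPoint (a.1, t) = P ∧
    t.1 a.2.1.1 + t.1 a.2.1.2 = n}) (by
    rintro ⟨k, ⟨⟨i, j⟩, h⟩⟩ ⟨k', ⟨⟨i', j'⟩, h'⟩⟩ hab
    rcases hab with ⟨h1, h2⟩ | ⟨l, h1, h2, h3, h4⟩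
    · simp only [Prod.swap_prod_mk, Prod.mk.injEq] at h1 h2
      obtain ⟨rfl, rfl⟩ := h2
      subst h1
      simp only [add_comm]
    · simp only [Prod.mk.injEq] at h1 h2 h3 h4
      obtain ⟨rfl, rfl⟩ := h4
      subst h3
      -- A point on the edge `ij` has zero coordinate at `l`, so the pairing of the face opposite
      -- `l` identifies it.
      have key : ∀ t : SimplexPoint n, t.1 i + t.1 j = n →
          T.toIntegralPoint (k, t) = T.toIntegralPoint (T.nbr k l, t.permute (T.perm k l)) :=
        fun t ht => by
          obtain ⟨m, hmi, hmj, hml⟩ := exists_fourth i j l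
          have hs := sum_fin_four h h2.symm h1.symm hmi hmj hml t.1
          have ht' := t.2.1
          exact Quot.sound ⟨l, by dsimp only at hs ht ⊢; omega, rfl⟩
      ext P
      constructor
      · rintro ⟨t, rfl, ht⟩
        exact ⟨t.permute (T.perm k l), (key t ht).symm, by simpa [SimplexPoint.permute] using ht⟩
      · rintro ⟨t, rfl, ht⟩
        have ht' : (t.permute (T.perm k l).symm).1 i + (t.permute (T.perm k l).symm).1 j = n := by
          simpa [SimplexPoint.permute] using ht
        refine ⟨t.permute (T.perm k l).symm, ?_, ht'⟩
        rw [key _ ht']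
        congr 2
        ext m
        simp [SimplexPoint.permute])

theorem ncard_cellPoints_le [Finite K] (e : T.OneCell) : (T.cellPoints n e).ncard ≤ n - 1 := by
  obtain ⟨k, i, j, hij, rfl⟩ := T.oneCell_cases e
  obtain ⟨l, hjl, hil⟩ : ∃ l : Fin 4, j ≠ l ∧ i ≠ l := by
    revert i j
    decide
  refine (Set.ncard_le_ncard (t := T.facePoints n k i j l (fun _ _ z => z = 0)) ?_).trans
    (T.ncard_facePoints_le k hij hjl hil _ (fun x _ _ => x - 1) ?_ ?_)
  · rintro P ⟨t, rfl, ht⟩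
    dsimp only at ht
    obtain ⟨m, hmi, hmj, hml⟩ := exists_fourth i j l
    have h1 := sum_fin_four hij hjl hil hmi hmj hml t.1
    have h2 := t.2.1
    exact ⟨t, rfl, by omega, by omega⟩
  · intros; omega
  · intros; omega

theorem ncard_edgePoints_le [Finite K] (G : Set T.OneCell) :
    (T.edgePoints n G).ncard ≤ G.ncard * (n - 1) := by
  classical
  have h1 : T.edgePoints n G ⊆ ⋃ e ∈ (Set.toFinite G).toFinset, T.cellPoints n e := by
    rintro _ ⟨⟨k, t⟩, i, j, hij, rfl, h1, h2⟩
    simp only [Set.Finite.mem_toFinset, Set.mem_iUnion]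
    exact ⟨_, h2, t, rfl, h1⟩
  refine (Set.ncard_le_ncard h1).trans ((Finset.set_ncard_biUnion_le _ _).trans ?_)
  refine (Finset.sum_le_card_nsmul _ _ (n - 1) fun e _ => T.ncard_cellPoints_le e).trans ?_
  rw [Set.ncard_eq_toFinset_card G, smul_eq_mul]

theorem card_index [Finite K] : Nat.card (T.Cusp × Fin (n - 1)) = Nat.card T.Cusp * (n - 1) := by
  rw [Nat.card_prod, Nat.card_fin]

/-! ### The three families -/

/-- With a single cusp the edge relation is symmetric under `j ↔ n-j` and the face relation under `j
↔ n-1-j`, so half of each row of points yields all relations. -/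
theorem columnsHaveDet_of_isOneCuspFamily [Finite K] (hn : 2 ≤ n) (hv : Nat.card T.Cusp = 1)
    {S : Set (T.IntegralPoint n)} (h : T.IsOneCuspFamily n S) :
    T.ColumnsHaveDet S n ∧ IsBasicGenerators (T.alphaStar n) S := by
  obtain ⟨k, a, b, c, hab, hbc, hac, hS⟩ := h
  have hsub : Subsingleton T.Cusp := (Nat.card_eq_one_iff_unique.1 hv).1
  set x₀ := T.cusp k a
  have h2 : ∀ j, 0 < j → j < n → T.genMod S x₀ j + T.genMod S x₀ (n - j) = 0 := by
    have h1 : ∀ j, 0 < j → j < n → j ≤ n - j →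
        T.genMod S x₀ j + T.genMod S x₀ (n - j) = 0 := by
      intro j h0 hj hle
      have := T.genMod_face hab hbc hac hS.ge (x := 0) (y := j) (z := n - j) (by omega) (by omega)
        (by omega) (by omega) ⟨by omega, h0, hle⟩
      rwa [genMod_zero, zero_add, Subsingleton.elim (T.cusp k b) x₀,
        Subsingleton.elim (T.cusp k c) x₀] at this
    intro j h0 hj
    obtain hle | hle := le_total j (n - j)
    · exact h1 j h0 hj hle
    · have := h1 (n - j) (by omega) (by omega) (by omega)
      rwa [add_comm, show n - (n - j) = j by omega] at this
  have h3 : ∀ j, 0 < j → j + 1 < n →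
      T.genMod S x₀ 1 + T.genMod S x₀ j + T.genMod S x₀ (n - 1 - j) = 0 := by
    have h1 : ∀ j, 0 < j → j + 1 < n → j ≤ n - 1 - j →
        T.genMod S x₀ 1 + T.genMod S x₀ j + T.genMod S x₀ (n - 1 - j) = 0 := by
      intro j h0 hj hle
      have := T.genMod_face hab hbc hac hS.ge (x := 1) (y := j) (z := n - 1 - j) (by omega)
        (by omega) (by omega) (by omega) ⟨by omega, h0, hle⟩
      rwa [Subsingleton.elim (T.cusp k b) x₀, Subsingleton.elim (T.cusp k c) x₀] at this
    intro j h0 hj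
    obtain hle | hle := le_total j (n - 1 - j)
    · exact h1 j h0 hj hle
    · have := h1 (n - 1 - j) (by omega) (by omega) (by omega)
      rwa [add_right_comm, show n - 1 - (n - 1 - j) = j by omega] at this
  obtain ⟨hna, hall⟩ := eq_smul_of_step hn (T.genMod S x₀) (fun j h0 hj => by
      have h4 := h2 (j + 1) (by omega) hj
      have h5 := h3 j h0 hj
      rw [show n - (j + 1) = n - 1 - j by omega] at h4
      have := h4.trans h5.symm
      rw [add_left_inj] at this
      rw [this, add_comm]) (by
      rw [add_comm]
      exact h2 1 (by omega) (by omega))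
  refine T.columnsHaveDet_and_isBasicGenerators n hn x₀ S ?_
    (T.span_weight_eq_ker n S _ hna fun x m h0 hm => Subsingleton.elim x x₀ ▸ hall m h0 hm)
  rw [card_index, hv, one_mul, Nat.card_coe_set_eq, hS]
  -- The numbering interleaves the rows: even values for `x = 0`, odd values for `x = 1`.
  refine T.ncard_facePoints_le k hab hbc hac _ (fun x y _ => 2 * y - 2 + x) ?_ ?_ <;>
    intros <;> omega

theorem card_union_edgePoints_le [Finite K] [Nonempty T.Cusp] {G : Set T.OneCell}
    (hG : T.IsMaximalTree G) {F : Set (T.IntegralPoint n)} (hF : F.ncard ≤ n - 1) :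
    Nat.card (F ∪ T.edgePoints n G : Set (T.IntegralPoint n)) ≤
      Nat.card (T.Cusp × Fin (n - 1)) := by
  rw [card_index, Nat.card_coe_set_eq]
  have h1 := Set.ncard_union_le F (T.edgePoints n G)
  have h2 := T.ncard_edgePoints_le (n := n) G
  have h3 := Nat.mul_le_mul_right (n - 1) (T.card_add_one_le_of_isMaximalTree G hG)
  rw [add_mul, one_mul] at h3
  omega

/-- The tree edge `bc` provides the edge relations between the cusp of `a` and `b` and that of `c`.
The closing relation comes from `(1, n-1, 0)`, which lies on the self edge `ab`. -/
theorem columnsHaveDet_of_isOneCycleFamily [Finite K] (hn : 2 ≤ n)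
    {S : Set (T.IntegralPoint n)} (h : T.IsOneCycleFamily n S) :
    T.ColumnsHaveDet S n ∧ IsBasicGenerators (T.alphaStar n) S := by
  obtain ⟨k, a, b, c, G, hab, hbc, hac, h1, -, hG, hGbc, hS⟩ := h
  have hS1 := Set.union_subset_iff.1 hS.ge
  have : Nonempty T.Cusp := ⟨T.cusp k a⟩
  have he : ∀ m, 0 < m → m < n →
      T.genMod S (T.cusp k a) m + T.genMod S (T.cusp k c) (n - m) = 0 := fun m h0 hm =>
    T.genMod_edge hS1.2 hGbc (by rw [ends_oneCell, h1]) h0 hm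
  have hf : ∀ j, 0 < j → j < n → T.genMod S (T.cusp k a) 1 + T.genMod S (T.cusp k a) j +
      T.genMod S (T.cusp k c) (n - 1 - j) = 0 := by
    intro j h0 hj
    have := T.genMod_face hab hbc hac hS1.1 (x := 1) (y := j) (z := n - 1 - j) (by omega)
      (by omega) (by omega) (by omega) ⟨rfl, h0⟩
    rwa [← h1] at this
  obtain ⟨hna, hall⟩ := eq_smul_of_step hn (T.genMod S (T.cusp k a)) (fun j h0 hj => by
      have h4 := he (j + 1) (by omega) hj
      have h5 := hf j h0 (by omega)
      rw [show n - (j + 1) = n - 1 - j by omega] at h4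
      have := h4.trans h5.symm
      rw [add_left_inj] at this
      rw [this, add_comm]) (by
      have := hf (n - 1) (by omega) (by omega)
      rwa [Nat.sub_self, genMod_zero, add_zero, add_comm] at this)
  refine T.columnsHaveDet_and_isBasicGenerators n hn (T.cusp k a) S ?_
    (T.span_weight_eq_ker n S _ hna (T.genMod_eq_smul_of_spans hS1.2 hG.1 hna _ hall))
  rw [hS]
  refine T.card_union_edgePoints_le hG ?_
  refine T.ncard_facePoints_le k hab hbc hac _ (fun _ y _ => y - 1) ?_ ?_ <;>
    intros <;> omega

/-- The edges `ab` and `bc` identify the classes of `e_1` at `a` and `c`, both being minus the class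
of `e_{n-1}` at `b`. The closing relation then comes from `(n-1, 0, 1)` on the edge `ac`. -/
theorem columnsHaveDet_of_isThreeCycleFamily [Finite K] (hn : 2 ≤ n)
    {S : Set (T.IntegralPoint n)} (h : T.IsThreeCycleFamily n S) :
    T.ColumnsHaveDet S n ∧ IsBasicGenerators (T.alphaStar n) S := by
  obtain ⟨k, a, b, c, G, hab, hbc, hac, -, -, -, hG, hGab, hGbc, hS⟩ := h
  have hS1 := Set.union_subset_iff.1 hS.ge
  have : Nonempty T.Cusp := ⟨T.cusp k a⟩
  have he : ∀ m, 0 < m → m < n →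
      T.genMod S (T.cusp k a) m + T.genMod S (T.cusp k b) (n - m) = 0 := fun m h0 hm =>
    T.genMod_edge hS1.2 hGab (T.ends_oneCell ..) h0 hm
  have hc : T.genMod S (T.cusp k c) 1 = T.genMod S (T.cusp k a) 1 := by
    have h2 := T.genMod_edge hS1.2 hGbc (T.ends_oneCell ..) (m := n - 1) (by omega) (by omega)
    have h3 := he 1 (by omega) (by omega)
    rw [show n - (n - 1) = 1 by omega, add_comm] at h2
    exact add_right_cancel (h2.trans h3.symm)
  have hf : ∀ j, 0 < j → j < n → T.genMod S (T.cusp k a) j + T.genMod S (T.cusp k b) (n - 1 - j) +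
      T.genMod S (T.cusp k a) 1 = 0 := by
    intro j h0 hj
    have := T.genMod_face hab hbc hac hS1.1 (x := j) (y := n - 1 - j) (z := 1) (by omega)
      (by omega) (by omega) (by omega) ⟨h0, rfl⟩
    rwa [hc] at this
  obtain ⟨hna, hall⟩ := eq_smul_of_step hn (T.genMod S (T.cusp k a)) (fun j h0 hj => by
      have h4 := he (j + 1) (by omega) hj
      have h5 := hf j h0 (by omega)
      rw [show n - (j + 1) = n - 1 - j by omega] at h4
      rw [add_right_comm] at h5
      exact add_right_cancel (h4.trans h5.symm)) (by
      have := hf (n - 1) (by omega) (by omega)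
      rwa [Nat.sub_self, genMod_zero, add_zero] at this)
  refine T.columnsHaveDet_and_isBasicGenerators n hn (T.cusp k a) S ?_
    (T.span_weight_eq_ker n S _ hna (T.genMod_eq_smul_of_spans hS1.2 hG.1 hna _ hall))
  rw [hS]
  refine T.card_union_edgePoints_le hG ?_
  refine T.ncard_facePoints_le k hab hbc hac _ (fun x _ _ => x - 1) ?_ ?_ <;>
    intros <;> omega

end Families

end IdealTriangulation

/-- Here `q` is `f` followed by the inverse of the isomorphism from `Span(J)` to the image. These
four properties are all that the coordinate ring argument needs. -/
theorem IsBasicGenerators.exists_projection {ι N : Type*} [AddCommGroup N]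
    {f : (ι →₀ ℤ) →ₗ[ℤ] N} {J : Set ι} (h : IsBasicGenerators f J) :
    ∃ q : (ι →₀ ℤ) →ₗ[ℤ] (ι →₀ ℤ), (∀ v, f v = 0 → q v = 0) ∧ (∀ v, f (q v) = f v) ∧
      (∀ v, q v ∈ Submodule.span ℤ ((fun j => Finsupp.single j (1 : ℤ)) '' J)) ∧
      ∀ j ∈ J, q (Finsupp.single j 1) = Finsupp.single j 1 := by
  set p := Submodule.span ℤ ((fun j => Finsupp.single j (1 : ℤ)) '' J)
  let e : p ≃ₗ[ℤ] LinearMap.range f := LinearEquiv.ofBijective (f.rangeRestrict ∘ₗ p.subtype) (by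
    constructor
    · intro v w hvw
      exact Subtype.ext (h.1 v.2 w.2 (congrArg Subtype.val hvw))
    · rintro ⟨y, hy⟩
      rw [← h.2] at hy
      obtain ⟨v, hv, rfl⟩ := hy
      exact ⟨⟨v, hv⟩, rfl⟩)
  have he : ∀ y, f (e.symm y) = y := fun y => congrArg Subtype.val (e.apply_symm_apply y)
  refine ⟨p.subtype ∘ₗ e.symm.toLinearMap ∘ₗ f.rangeRestrict, fun v hv => ?_, fun v => ?_,
    fun v => (e.symm _).2, fun j hj => ?_⟩
  · have : f.rangeRestrict v = 0 := Subtype.ext hv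
    simp [this]
  · exact he _
  · refine h.1 (e.symm _).2 (Submodule.subset_span ⟨j, hj, rfl⟩) (he _)

namespace IdealTriangulation

/-! ### The torus as `Hom(C₀ⁿ, ℂˣ)` and independence of its characters. -/

section Torus

variable {K : Type*} (T : IdealTriangulation K) {n : ℕ}

/-- The character of the torus elements, as a homomorphism on `C₀ⁿ`. -/
noncomputable def torusHom (x : T.Torus n) : T.C0 n →ₗ[ℤ] Additive ℂˣ :=
  (T.basisC0 n).constr ℤ fun r => Additive.ofMul (x r.1 r.2)

theorem torusHom_basis (x : T.Torus n) (r : T.Cusp × Fin (n - 1)) :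
    T.torusHom x (T.basisC0 n r) = Additive.ofMul (x r.1 r.2) :=
  Module.Basis.constr_basis ..

theorem gen_eq_sum (y : T.Cusp) (m : ℕ) :
    T.gen n y m = ∑ j, unitVec n m j • T.basisC0 n (y, j) := by
  have h : ∀ j, T.basisC0 n (y, j) = Finsupp.single y 1 ⊗ₜ[ℤ] Pi.single j 1 := fun j => by
    refine (Module.Basis.tensorProduct_apply' _ _ _).trans ?_
    simp
  have h2 : unitVec n m = ∑ j, unitVec n m j • (Pi.single j 1 : Fin (n - 1) → ℤ) := by
    funext l
    simp [Finset.sum_apply, Pi.single_apply]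
  rw [gen, h2, TensorProduct.tmul_sum]
  refine Finset.sum_congr rfl fun j _ => ?_
  rw [← h2, h, TensorProduct.tmul_smul]

theorem torusHom_weight (x : T.Torus n) (p : T.LabelledPoint n) :
    T.torusHom x (T.weight (T.toIntegralPoint p)) = Additive.ofMul (T.character x p) := by
  rw [weight_toIntegralPoint, map_sum, character, ofMul_prod]
  refine Finset.sum_congr rfl fun i _ => ?_
  rw [gen_eq_sum, map_sum, ofMul_prod]
  refine Finset.sum_congr rfl fun j _ => ?_
  rw [map_zsmul, torusHom_basis, ofMul_zpow]

theorem torusHom_mul (x y : T.Torus n) (w : T.C0 n) :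
    T.torusHom (x * y) w = T.torusHom x w + T.torusHom y w := by
  rw [← LinearMap.add_apply]
  congr 1
  refine (T.basisC0 n).ext fun r => ?_
  rw [LinearMap.add_apply, torusHom_basis, torusHom_basis, torusHom_basis]
  rfl

theorem torusHom_one (w : T.C0 n) : T.torusHom 1 w = 0 := by
  have := T.torusHom_mul 1 1 w
  rwa [one_mul, left_eq_add] at this

/-- An element of `C₀ⁿ` as a complex valued character of the torus. -/
noncomputable def torusChar (w : T.C0 n) : T.Torus n →* ℂ where
  toFun x := ((T.torusHom x w).toMul : ℂˣ)
  map_one' := by rw [torusHom_one]; rfl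
  map_mul' x y := by rw [torusHom_mul]; rfl

/-- The torus element with coordinate `2` at `r` and `1` elsewhere reads off the exponent at `r`,
since the powers of `2` are distinct. -/
theorem torusChar_injective : Function.Injective (T.torusChar (n := n)) := by
  classical
  intro w w' h
  refine (T.basisC0 n).ext_elem fun r => ?_
  have key : ∀ w : T.C0 n, T.torusChar w
      (fun c j => if (c, j) = r then Units.mk0 2 two_ne_zero else 1) =
      (2 : ℂ) ^ (T.basisC0 n).repr w r := by
    intro w
    change ((T.torusHom _ w).toMul : ℂˣ).1 = _
    rw [torusHom, Module.Basis.constr_apply, Finsupp.sum_eq_single r]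
    · simp
    · intro b _ hb
      simp [hb]
    · simp
  have h2 := key w
  rw [h, key w'] at h2
  have h3 := congrArg norm h2
  rw [norm_zpow, norm_zpow, Complex.norm_ofNat] at h3
  exact (zpow_right_injective₀ (by norm_num) (by norm_num) h3).symm

/-- If a sum of weight vectors is invariant under the torus, it equals the sum of its terms of
weight zero. -/
theorem sum_eq_sum_weight_zero {I V : Type*} [AddCommGroup V] [Module ℂ V] (s : Finset I)
    (w : I → T.C0 n) (y : I → V)
    (h : ∀ x, ∑ i ∈ s, T.torusChar (w i) x • y i = ∑ i ∈ s, y i) [DecidablePred fun i => w i = 0] :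
    ∑ i ∈ s, y i = ∑ i ∈ s with w i = 0, y i := by
  -- Linear functionals reduce the claim to scalars, where invariance is a linear relation between
  -- characters; by their independence the coefficient of the trivial character vanishes.
  rw [← sub_eq_zero, ← Module.forall_dual_apply_eq_zero_iff ℂ]
  intro φ
  have hli : LinearIndependent ℂ fun w : T.C0 n => (T.torusChar w : T.Torus n → ℂ) :=
    (linearIndependent_monoidHom (T.Torus n) ℂ).comp _ T.torusChar_injective
  have h0 : (∑ i ∈ s, Finsupp.single (w i) (φ (y i)) -
      Finsupp.single (0 : T.C0 n) (φ (∑ i ∈ s, y i)) : T.C0 n →₀ ℂ) = 0 := by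
    refine hli ?_
    rw [map_zero, map_sub, map_sum]
    funext x
    have h1 : T.torusChar 0 x = 1 := by simp [torusChar]
    have h2 := congrArg φ (h x)
    simp only [map_sum, map_smul, smul_eq_mul] at h2
    simp [Finsupp.linearCombination_single, h1, ← h2, mul_comm]
  have h1 := DFunLike.congr_fun h0 0
  classical
  simp only [Finsupp.coe_sub, Pi.sub_apply, Finsupp.finsetSum_apply, Finsupp.single_apply,
    Finsupp.coe_zero, Pi.zero_apply, if_true] at h1
  rw [map_sub, ← neg_eq_zero, neg_sub, map_sum φ _ (Finset.filter _ _), Finset.sum_filter]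
  convert h1

theorem exists_torusHom_eq (f : T.C0 n →ₗ[ℤ] Additive ℂˣ) : ∃ x, T.torusHom x = f :=
  ⟨fun c j => (f (T.basisC0 n (c, j))).toMul, (T.basisC0 n).ext fun r => T.torusHom_basis _ r⟩

/-- Roots exist in `ℂ`, so `ℂˣ` is divisible, hence injective. This is needed since the image of
`α*` need not be all of `C₀ⁿ`: extending a homomorphism may require extracting roots. -/
theorem baer_units_complex : Module.Baer ℤ (Additive ℂˣ) := by
  have : DivisibleBy (Additive ℂˣ) ℕ := divisibleByOfSMulRightSurj _ _ (by
    intro m hm a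
    obtain ⟨z, hz⟩ := IsAlgClosed.exists_pow_nat_eq (a.toMul : ℂ) (Nat.pos_of_ne_zero hm)
    have hz0 : z ≠ 0 := by
      rintro rfl
      rw [zero_pow hm] at hz
      exact a.toMul.ne_zero hz.symm
    refine ⟨Additive.ofMul (Units.mk0 z hz0), ?_⟩
    apply Additive.toMul.injective
    ext
    simpa using hz)
  have := AddGroup.divisibleByIntOfDivisibleByNat (Additive ℂˣ)
  exact Module.Baer.of_divisible _

end Torus

/-! ### The projection of the coordinate ring onto its invariants. -/

section CoordinateRing

variable {K : Type*} (T : IdealTriangulation K) {n : ℕ}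

/-! ### Monomials and their weights -/

/-- The common weight of the three terms of a Ptolemy relation. -/
noncomputable def ptolemyWeight (n : ℕ) (k : K) (a : Fin 4 → ℕ) : T.C0 n :=
  ∑ i, (T.gen n (T.cusp k i) (a i) + T.gen n (T.cusp k i) (a i + 1))

/-- The edges `ij` and `lm` are opposite, so each vertex is raised by one in exactly one of the two
points, whichever pair of opposite edges is taken. -/
theorem weight_addEdge (k : K) (a : Fin 4 → ℕ)
    (ha : ∑ i, a i + 2 = n) (i j l m : Fin 4) (hij : i ≠ j) (hlm : l ≠ m)
    (h : i ≠ l ∧ i ≠ m ∧ j ≠ l ∧ j ≠ m) :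
    T.weight (T.toIntegralPoint (k, .addEdge a ha i j hij)) +
      T.weight (T.toIntegralPoint (k, .addEdge a ha l m hlm)) = T.ptolemyWeight n k a := by
  rw [weight_toIntegralPoint, weight_toIntegralPoint, ptolemyWeight, ← Finset.sum_add_distrib]
  unfold SimplexPoint.addEdge
  refine Finset.sum_congr rfl fun r _ => ?_
  have hr : r = i ∨ r = j ∨ r = l ∨ r = m := by
    revert i j l m r
    decide
  obtain ⟨h1, h2, h3, h4⟩ := h
  rcases hr with rfl | rfl | rfl | rfl
  · simp [hij, h1, h2, add_comm]
  · simp [hij.symm, h3, h4, add_comm]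
  · simp [h1.symm, h3.symm, hlm]
  · simp [h2.symm, h4.symm, hlm.symm]

/-- The formal sum of integral points underlying a monomial; dummy variables count negatively. -/
noncomputable def monomialPoints :
    ((T.LabelledPoint n ⊕ T.LabelledPoint n) →₀ ℕ) →ₗ[ℕ] T.C1 n :=
  Finsupp.linearCombination ℕ (Sum.elim (fun p => Finsupp.single (T.toIntegralPoint p) 1)
    (fun p => -Finsupp.single (T.toIntegralPoint p) 1))

/-- The Laurent monomial in the elements `g P` with given exponent vector. -/
noncomputable def laurent {G : Type*} [CommGroup G] (g : T.IntegralPoint n → G) (v : T.C1 n) : G :=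
  v.prod fun P k => g P ^ k

section Laurent

variable {G : Type*} [CommGroup G] (g : T.IntegralPoint n → G)

theorem laurent_zero : T.laurent g 0 = 1 := Finsupp.prod_zero_index

theorem laurent_add (v w : T.C1 n) : T.laurent g (v + w) = T.laurent g v * T.laurent g w :=
  Finsupp.prod_add_index' (fun _ => zpow_zero _) (fun _ => zpow_add _)

theorem laurent_single (P : T.IntegralPoint n) : T.laurent g (Finsupp.single P 1) = g P := by
  rw [laurent, Finsupp.prod_single_index (zpow_zero _), zpow_one]

theorem laurent_mul (g' : T.IntegralPoint n → G) (v : T.C1 n) :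
    T.laurent (fun P => g P * g' P) v = T.laurent g v * T.laurent g' v := by
  simp only [laurent, mul_zpow, Finsupp.prod_mul]

theorem map_laurent {H : Type*} [CommGroup H] (φ : G →* H) (v : T.C1 n) :
    φ (T.laurent g v) = T.laurent (fun P => φ (g P)) v := by
  simp only [laurent, map_finsuppProd, map_zpow]

theorem laurent_eq_one {S : Set (T.IntegralPoint n)} (hS : ∀ P ∈ S, g P = 1) {v : T.C1 n}
    (hv : v ∈ Submodule.span ℤ ((fun P => Finsupp.single P (1 : ℤ)) '' S)) :
    T.laurent g v = 1 := by
  rw [← Finsupp.supported_eq_span_single, Finsupp.mem_supported] at hv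
  refine Finset.prod_eq_one fun P hP => ?_
  dsimp only
  rw [hS P (hv hP), one_zpow]

end Laurent

theorem torusHom_alphaStar (x : T.Torus n) {rep : T.IntegralPoint n → T.LabelledPoint n}
    (hrep : ∀ P, T.toIntegralPoint (rep P) = P) (v : T.C1 n) :
    (T.torusHom x (T.alphaStar n v)).toMul = T.laurent (fun P => T.character x (rep P)) v := by
  rw [alphaStar, Finsupp.linearCombination_apply, map_finsuppSum, Finsupp.sum, toMul_sum, laurent]
  refine Finset.prod_congr rfl fun P _ => ?_
  have h := T.torusHom_weight x (rep P)
  rw [hrep] at h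
  rw [map_zsmul, toMul_zsmul, h, toMul_ofMul]

/-- A homomorphism that scales the Ptolemy coordinates by units scales each monomial. -/
theorem scale_monomial {A : Type*} [CommRing A] [Algebra ℂ A] (ψ φ : T.PolyRing n →ₐ[ℂ] A)
    (L : T.C1 n → Aˣ) (hL0 : L 0 = 1) (hL : ∀ v w, L (v + w) = L v * L w)
    (h1 : ∀ p : T.LabelledPoint n, φ (.X (.inl p)) =
      (L (Finsupp.single (T.toIntegralPoint p) 1)).1 * ψ (.X (.inl p)))
    (h2 : ∀ p : T.LabelledPoint n, φ (.X (.inr p)) =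
      (L (Finsupp.single (T.toIntegralPoint p) 1))⁻¹.1 * ψ (.X (.inr p)))
    (s : (T.LabelledPoint n ⊕ T.LabelledPoint n) →₀ ℕ) (a : ℂ) :
    φ (.monomial s a) = (L (T.monomialPoints s)).1 * ψ (.monomial s a) := by
  have hneg : ∀ v, L (-v) = (L v)⁻¹ := fun v => by
    rw [eq_inv_iff_mul_eq_one, ← hL, neg_add_cancel, hL0]
  have key : φ (.monomial s 1) = (L (T.monomialPoints s)).1 * ψ (.monomial s 1) := by
    induction s using Finsupp.induction_linear with
    | zero => simp [hL0]
    | add s t hs ht =>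
      have : (MvPolynomial.monomial (s + t) 1 : T.PolyRing n) =
          .monomial s 1 * .monomial t 1 := by simp [MvPolynomial.monomial_mul]
      rw [this, map_mul, map_mul, hs, ht, map_add, hL, Units.val_mul]
      ring
    | single v k =>
      have hv : φ (.X v) = (L (T.monomialPoints (Finsupp.single v 1))).1 * ψ (.X v) := by
        obtain p | p := v
        · simpa [monomialPoints] using h1 p
        · simpa [monomialPoints, hneg] using h2 p
      have hk : L (T.monomialPoints (Finsupp.single v k)) =
          L (T.monomialPoints (Finsupp.single v 1)) ^ k := by
        induction k with
        | zero => simp [hL0]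
        | succ k ih => rw [Finsupp.single_add, map_add, hL, ih, pow_succ]
      rw [← MvPolynomial.X_pow_eq_monomial, map_pow, map_pow, hv, mul_pow, hk,
        Units.val_pow_eq_pow_val]
  rw [← mul_one a, ← smul_eq_mul, ← MvPolynomial.smul_monomial, map_smul, map_smul, key,
    mul_smul_comm]

/-! ### The projection onto the invariants

In this section `A` is the coordinate ring, presented by the surjection `ψ`, and the units `u p` are
the Ptolemy coordinates. -/

section Projection

variable {A : Type*} [CommRing A] [Algebra ℂ A] {ψ : T.PolyRing n →ₐ[ℂ] A}
  {u : T.LabelledPoint n → Aˣ} {rep : T.IntegralPoint n → T.LabelledPoint n}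
  {q : T.C1 n →ₗ[ℤ] T.C1 n}

variable (rep q) in
/-- The Laurent monomial in the `u (rep P)`, `P` an integral point, by which `u p` is divided by
the projection to the invariants. -/
noncomputable def denom {G : Type*} [CommGroup G] (u : T.LabelledPoint n → G)
    (p : T.LabelledPoint n) : G :=
  T.laurent (fun P => u (rep P)) (q (Finsupp.single (T.toIntegralPoint p) 1))

variable (u rep q) in
/-- The substitution that divides the Ptolemy coordinates by `denom`. -/
noncomputable def polyProj : T.PolyRing n →ₐ[ℂ] A :=
  MvPolynomial.aeval (Sum.elim (fun p => (T.denom rep q u p)⁻¹.1 * (u p).1)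
    (fun p => (T.denom rep q u p).1 * (u p)⁻¹.1))

theorem polyProj_inl (p : T.LabelledPoint n) :
    T.polyProj u rep q (.X (.inl p)) = (T.denom rep q u p)⁻¹.1 * (u p).1 := by
  rw [polyProj, MvPolynomial.aeval_X, Sum.elim_inl]

theorem polyProj_inr (p : T.LabelledPoint n) :
    T.polyProj u rep q (.X (.inr p)) = (T.denom rep q u p).1 * (u p)⁻¹.1 := by
  rw [polyProj, MvPolynomial.aeval_X, Sum.elim_inr]

theorem eq_of_alphaStar_eq (hq : ∀ v, T.alphaStar n v = 0 → q v = 0)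
    {v w : T.C1 n} (h : T.alphaStar n v = T.alphaStar n w) : q v = q w := by
  rw [← sub_eq_zero, ← map_sub]
  exact hq _ (by rw [map_sub, h, sub_self])

/-- Since `q` kills the kernel of `α*`, denominators of products depend only on the weight. The
three terms of a Ptolemy relation have equal weight and are divided by the same unit; glued points
are one integral point and share their denominator. -/
theorem polyProj_relation (hu : ∀ p, ψ (.X (.inl p)) = (u p).1)
    (hψ : ∀ f ∈ T.relationIdeal n, ψ f = 0)
    (hq : ∀ v, T.alphaStar n v = 0 → q v = 0) :
    ∀ f ∈ T.relationIdeal n, T.polyProj u rep q f = 0 := by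
  suffices T.relationIdeal n ≤ RingHom.ker (T.polyProj u rep q) from fun f hf => this hf
  rw [relationIdeal, Ideal.span_le]
  rintro f (⟨k, a, ha, rfl⟩ | ⟨p, i, hp, rfl⟩ | ⟨p, rfl⟩) <;> rw [SetLike.mem_coe, RingHom.mem_ker]
  · have h0 : T.polyProj u rep q (T.ptolemyExpr (fun p => .X (.inl p)) k a ha) =
        T.ptolemyExpr (fun p => (T.denom rep q u p)⁻¹.1 * (u p).1) k a ha := by
      simp only [ptolemyExpr, map_sub, map_add, map_mul, polyProj_inl]
    rw [h0]
    have hw := T.weight_addEdge k a ha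
    have key : ∀ {p p' r r' : T.LabelledPoint n},
        T.weight (T.toIntegralPoint p) + T.weight (T.toIntegralPoint p') =
          T.weight (T.toIntegralPoint r) + T.weight (T.toIntegralPoint r') →
        (T.denom rep q u p)⁻¹.1 * (T.denom rep q u p')⁻¹.1 =
          (T.denom rep q u r)⁻¹.1 * (T.denom rep q u r')⁻¹.1 := by
      intro p p' r r' h
      rw [← Units.val_mul, ← Units.val_mul, ← mul_inv, ← mul_inv]
      unfold denom
      rw [← laurent_add, ← laurent_add, ← map_add, ← map_add]
      congr 3
      exact T.eq_of_alphaStar_eq hq (by simp only [map_add, alphaStar_single, h])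
    have e1 := key ((hw 0 1 2 3 (by decide) (by decide) (by decide)).trans
      (hw 0 3 1 2 (by decide) (by decide) (by decide)).symm)
    have e2 := key ((hw 0 2 1 3 (by decide) (by decide) (by decide)).trans
      (hw 0 3 1 2 (by decide) (by decide) (by decide)).symm)
    have h1 : T.ptolemyExpr (fun p => (u p).1) k a ha = 0 := by
      rw [← hψ _ (Ideal.subset_span (Or.inl ⟨k, a, ha, rfl⟩))]
      simp only [ptolemyExpr, map_sub, map_add, map_mul, hu]
    unfold ptolemyExpr at h1 ⊢
    rw [mul_mul_mul_comm, mul_mul_mul_comm _ (u (k, .addEdge a ha 0 1 _)).1,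
      mul_mul_mul_comm _ (u (k, .addEdge a ha 0 2 _)).1, e1, e2, ← mul_add, ← mul_sub,
      h1, mul_zero]
  · have hg : T.denom rep q u (T.glue p i) = T.denom rep q u p := by
      have : T.toIntegralPoint (T.glue p i) = T.toIntegralPoint p :=
        (Quot.sound ⟨i, hp, rfl⟩ : T.toIntegralPoint p = _).symm
      rw [denom, this, denom]
    have h1 := hψ _ (Ideal.subset_span (Or.inr (Or.inl ⟨p, i, hp, rfl⟩)))
    rw [map_sub, map_mul, hu, hu, MvPolynomial.algHom_C] at h1
    rw [map_sub, map_mul, MvPolynomial.algHom_C, polyProj_inl, polyProj_inl, hg]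
    linear_combination (T.denom rep q u p)⁻¹.1 * h1
  · rw [map_sub, map_mul, map_one, polyProj_inl, polyProj_inr, mul_mul_mul_comm, Units.inv_mul,
      Units.mul_inv, mul_one, sub_self]

/-- Because `α* ∘ q = α*`, the denominator of `u p` is scaled by the same character as `u p`, so
their quotient is invariant. -/
theorem map_denom_of_character (hrep : ∀ P, T.toIntegralPoint (rep P) = P)
    (hq' : ∀ v, T.alphaStar n (q v) = T.alphaStar n v) (x : T.Torus n) {a : A →ₐ[ℂ] A}
    (ha : ∀ p, a (u p).1 = algebraMap ℂ A (T.character x p) * (u p).1) (p : T.LabelledPoint n) :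
    Units.map (a : A →* A) (T.denom rep q u p) =
      Units.map (algebraMap ℂ A : ℂ →* A) (T.character x p) * T.denom rep q u p := by
  have h : ∀ P, Units.map (a : A →* A) (u (rep P)) =
      Units.map (algebraMap ℂ A : ℂ →* A) (T.character x (rep P)) * u (rep P) :=
    fun P => Units.ext (ha (rep P))
  rw [denom, map_laurent, funext h, laurent_mul, ← map_laurent, ← T.torusHom_alphaStar x hrep, hq',
    alphaStar_single, torusHom_weight, toMul_ofMul]

theorem map_polyProj_of_character (hrep : ∀ P, T.toIntegralPoint (rep P) = P)
    (hq' : ∀ v, T.alphaStar n (q v) = T.alphaStar n v) (x : T.Torus n) {a : A →ₐ[ℂ] A}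
    (ha : ∀ p, a (u p).1 = algebraMap ℂ A (T.character x p) * (u p).1) (f : T.PolyRing n) :
    a (T.polyProj u rep q f) = T.polyProj u rep q f := by
  have hd := T.map_denom_of_character hrep hq' x ha
  have hu : ∀ p, Units.map (a : A →* A) (u p) =
      Units.map (algebraMap ℂ A : ℂ →* A) (T.character x p) * u p := fun p => Units.ext (ha p)
  suffices a.comp (T.polyProj u rep q) = T.polyProj u rep q from DFunLike.congr_fun this f
  refine MvPolynomial.algHom_ext fun v => ?_
  obtain p | p := v
  · have h : Units.map (a : A →* A) ((T.denom rep q u p)⁻¹ * u p) =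
        (T.denom rep q u p)⁻¹ * u p := by
      rw [map_mul, map_inv, hd, hu, mul_inv, mul_mul_mul_comm, inv_mul_cancel, one_mul]
    rw [AlgHom.comp_apply, polyProj_inl]
    exact congrArg Units.val h
  · have h : Units.map (a : A →* A) (T.denom rep q u p * (u p)⁻¹) =
        T.denom rep q u p * (u p)⁻¹ := by
      rw [map_mul, map_inv, hd, hu, mul_inv, mul_mul_mul_comm, mul_inv_cancel, one_mul]
    rw [AlgHom.comp_apply, polyProj_inr]
    exact congrArg Units.val h

/-- Exponents in the image of `q` are supported on `S`, so all denominators become `1` modulo `I`.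
-/
theorem polyProj_sub_mem (hu : ∀ p, ψ (.X (.inl p)) = (u p).1)
    (hu' : ∀ p, ψ (.X (.inr p)) = (u p)⁻¹.1) {S : Set (T.IntegralPoint n)}
    (hS : ∀ v, q v ∈ Submodule.span ℤ ((fun P => Finsupp.single P (1 : ℤ)) '' S))
    {I : Ideal A} (hI : ∀ P ∈ S, (u (rep P)).1 - 1 ∈ I) (f : T.PolyRing n) :
    T.polyProj u rep q f - ψ f ∈ I := by
  let π : A →ₐ[ℂ] A ⧸ I := Ideal.Quotient.mkₐ ℂ I
  have hπ : ∀ P ∈ S, π (u (rep P)).1 = 1 := fun P hP =>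
    (Ideal.Quotient.mk_eq_mk_iff_sub_mem _ _).2 (hI P hP)
  have hone : ∀ p, Units.map (π : A →* A ⧸ I) (T.denom rep q u p) = 1 := by
    intro p
    rw [denom, map_laurent]
    exact T.laurent_eq_one _ (fun P hP => Units.ext (hπ P hP)) (hS _)
  suffices π.comp (T.polyProj u rep q) = π.comp ψ from
    (Ideal.Quotient.mk_eq_mk_iff_sub_mem _ _).1 (DFunLike.congr_fun this f)
  refine MvPolynomial.algHom_ext fun v => ?_
  obtain p | p := v
  · have h : Units.map (π : A →* A ⧸ I) ((T.denom rep q u p)⁻¹ * u p) =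
        Units.map (π : A →* A ⧸ I) (u p) := by
      rw [map_mul, map_inv, hone, inv_one, one_mul]
    rw [AlgHom.comp_apply, AlgHom.comp_apply, polyProj_inl, hu]
    exact congrArg Units.val h
  · have h : Units.map (π : A →* A ⧸ I) (T.denom rep q u p * (u p)⁻¹) =
        Units.map (π : A →* A ⧸ I) (u p)⁻¹ := by
      rw [map_mul, hone, one_mul]
    rw [AlgHom.comp_apply, AlgHom.comp_apply, polyProj_inr, hu']
    exact congrArg Units.val h

/-- An element fixed by the torus is fixed by the projection. -/
theorem polyProj_eq_of_invariant (hu : ∀ p, ψ (.X (.inl p)) = (u p).1)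
    (hu' : ∀ p, ψ (.X (.inr p)) = (u p)⁻¹.1) (hψ : ∀ f ∈ T.relationIdeal n, ψ f = 0)
    (hψ' : ∀ f, ψ f = 0 → f ∈ T.relationIdeal n)
    (hq : ∀ v, T.alphaStar n v = 0 → q v = 0) (F : T.PolyRing n)
    (hF : ∀ x, ψ (T.polyAct x F) = ψ F) : T.polyProj u rep q F = ψ F := by
  classical
  let m : ((T.LabelledPoint n ⊕ T.LabelledPoint n) →₀ ℕ) → T.PolyRing n := fun s =>
    .monomial s (F.coeff s)
  have hsum : F = ∑ s ∈ F.support, m s := F.as_sum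
  have hact : ∀ x s, ψ (T.polyAct x (m s)) =
      T.torusChar (T.alphaStar n (T.monomialPoints s)) x • ψ (m s) := by
    intro x s
    have := T.scale_monomial ψ (ψ.comp (T.polyAct x))
      (fun v => Units.map (algebraMap ℂ A : ℂ →* A) (T.torusHom x (T.alphaStar n v)).toMul)
      (by simp) (fun v w => by simp)
      (fun p => by
        rw [alphaStar_single, torusHom_weight, AlgHom.comp_apply, polyAct, MvPolynomial.aeval_X,
          Sum.elim_inl, map_mul, MvPolynomial.algHom_C]
        rfl)
      (fun p => by
        rw [alphaStar_single, torusHom_weight, AlgHom.comp_apply, polyAct, MvPolynomial.aeval_X,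
          Sum.elim_inr, map_mul, MvPolynomial.algHom_C, ← map_inv]
        rfl) s (F.coeff s)
    rw [Algebra.smul_def]
    exact this
  -- The denominator of a monomial of weight zero is trivial, because `q` kills its exponent.
  have hproj : ∀ s, T.alphaStar n (T.monomialPoints s) = 0 →
      T.polyProj u rep q (m s) = ψ (m s) := by
    intro s hs
    have := T.scale_monomial ψ (T.polyProj u rep q)
      (fun v => (T.laurent (fun P => u (rep P)) (q v))⁻¹)
      (by rw [map_zero, laurent_zero, inv_one])
      (fun v w => by rw [map_add, laurent_add, mul_inv])
      (fun p => by rw [polyProj_inl, hu, denom])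
      (fun p => by rw [polyProj_inr, hu', inv_inv, denom]) s (F.coeff s)
    rwa [hq _ hs, laurent_zero, inv_one, Units.val_one, one_mul] at this
  -- `F` is invariant only modulo the relations, so its weight zero part is extracted in `A`. It
  -- differs from `F` by an element of the relation ideal, which the projection kills.
  have hzero : ψ F = ψ (∑ s ∈ F.support with T.alphaStar n (T.monomialPoints s) = 0, m s) := by
    rw [map_sum]
    conv_lhs => rw [hsum, map_sum]
    refine T.sum_eq_sum_weight_zero F.support
      (fun s => T.alphaStar n (T.monomialPoints s)) (fun s => ψ (m s)) fun x => ?_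
    have := hF x
    conv at this => rw [hsum, map_sum, map_sum, map_sum]
    rw [← this]
    exact Finset.sum_congr rfl fun s _ => (hact x s).symm
  rw [← sub_eq_zero, ← map_sub] at hzero
  have h1 := T.polyProj_relation (rep := rep) hu hψ hq _ (hψ' _ hzero)
  rw [map_sub, sub_eq_zero] at h1
  rw [map_sub, sub_eq_zero] at hzero
  rw [h1, hzero, map_sum, map_sum]
  exact Finset.sum_congr rfl fun s hs => hproj s (Finset.mem_filter.1 hs).2

end Projection

/-! ### The coordinate ring -/

/-- The class of the Ptolemy coordinate at `p`, as a unit of the coordinate ring. -/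
noncomputable def coordUnit (p : T.LabelledPoint n) : (T.CoordRing n)ˣ :=
  have h : Ideal.Quotient.mkₐ ℂ (T.relationIdeal n) (.X (.inl p) * .X (.inr p)) = 1 := by
    rw [← sub_eq_zero, ← map_one (Ideal.Quotient.mkₐ ℂ (T.relationIdeal n)), ← map_sub]
    exact Ideal.Quotient.eq_zero_iff_mem.2 (Ideal.subset_span (Or.inr (Or.inr ⟨p, rfl⟩)))
  ⟨Ideal.Quotient.mkₐ ℂ (T.relationIdeal n) (.X (.inl p)),
    Ideal.Quotient.mkₐ ℂ (T.relationIdeal n) (.X (.inr p)), by rw [← map_mul, h],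
    by rw [mul_comm, ← map_mul, h]⟩

theorem coordAct_coordUnit (x : T.Torus n) (p : T.LabelledPoint n) :
    T.coordAct x (T.coordUnit p).1 =
      algebraMap ℂ _ (T.character x p).1 * (T.coordUnit p).1 := by
  change Ideal.Quotient.mkₐ ℂ (T.relationIdeal n) (T.polyAct x (.X (.inl p))) = _
  rw [polyAct, MvPolynomial.aeval_X, Sum.elim_inl, map_mul, MvPolynomial.algHom_C]
  rfl

theorem mem_invariantRing (f : T.CoordRing n) :
    f ∈ T.invariantRing n ↔ ∀ x, T.coordAct x f = f := by
  simp [invariantRing, Algebra.mem_iInf]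

/-- The projection of the coordinate ring to its invariants along the ideal generated by the
elements `c_P - 1`, `P ∈ S`. -/
theorem exists_coordProj {S : Set (T.IntegralPoint n)}
    (h : IsBasicGenerators (T.alphaStar n) S) {rep : T.IntegralPoint n → T.LabelledPoint n}
    (hrep : ∀ P, T.toIntegralPoint (rep P) = P) :
    ∃ ρ : T.CoordRing n →ₐ[ℂ] T.CoordRing n, (∀ f, ρ f ∈ T.invariantRing n) ∧
      (∀ f, Ideal.Quotient.mk (T.sliceIdeal rep S) (ρ f) =
        Ideal.Quotient.mk (T.sliceIdeal rep S) f) ∧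
      (∀ f ∈ T.sliceIdeal rep S, ρ f = 0) ∧ ∀ f ∈ T.invariantRing n, ρ f = f := by
  obtain ⟨q, hq, hq', hspan, hS⟩ := h.exists_projection
  let ψ : T.PolyRing n →ₐ[ℂ] T.CoordRing n := Ideal.Quotient.mkₐ ℂ (T.relationIdeal n)
  have hu : ∀ p, ψ (.X (.inl p)) = (T.coordUnit p).1 := fun _ => rfl
  have hu' : ∀ p, ψ (.X (.inr p)) = (T.coordUnit p)⁻¹.1 := fun _ => rfl
  have hψ : ∀ f ∈ T.relationIdeal n, ψ f = 0 := fun f => Ideal.Quotient.eq_zero_iff_mem.2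
  have hψ' : ∀ f, ψ f = 0 → f ∈ T.relationIdeal n := fun f => Ideal.Quotient.eq_zero_iff_mem.1
  let ρ : T.CoordRing n →ₐ[ℂ] T.CoordRing n := Ideal.Quotient.liftₐ _
    (T.polyProj T.coordUnit rep q) (T.polyProj_relation hu hψ hq)
  have hρ : ∀ f, ρ (ψ f) = T.polyProj T.coordUnit rep q f := fun f => rfl
  have hsurj : Function.Surjective ψ := Ideal.Quotient.mk_surjective
  refine ⟨ρ, fun f => ?_, fun f => ?_, ?_, fun f hf => ?_⟩
  · obtain ⟨F, rfl⟩ := hsurj f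
    exact (T.mem_invariantRing _).2
      fun x => T.map_polyProj_of_character hrep hq' x (T.coordAct_coordUnit x) F
  · obtain ⟨F, rfl⟩ := hsurj f
    have hI : ∀ P ∈ S, (T.coordUnit (rep P)).1 - 1 ∈ T.sliceIdeal rep S :=
      fun P hP => Ideal.subset_span ⟨P, hP, rfl⟩
    exact (Ideal.Quotient.mk_eq_mk_iff_sub_mem _ _).2 (T.polyProj_sub_mem hu hu' hspan hI F)
  · suffices T.sliceIdeal rep S ≤ RingHom.ker ρ from fun f hf => this hf
    rw [sliceIdeal, Ideal.span_le]
    rintro _ ⟨P, hP, rfl⟩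
    have h1 : T.polyProj T.coordUnit rep q (.X (.inl (rep P))) = 1 := by
      rw [polyProj_inl, denom, hrep, hS P hP, laurent_single, Units.inv_mul]
    exact (map_sub ρ _ _).trans (sub_eq_zero.2 (h1.trans (map_one ρ).symm))
  · obtain ⟨F, rfl⟩ := hsurj f
    exact T.polyProj_eq_of_invariant hu hu' hψ hψ' hq F ((T.mem_invariantRing _).1 hf)

/-- The ring of invariants is the coordinate ring of the slice. -/
theorem bijective_invariantRing_to_quotient {S : Set (T.IntegralPoint n)}
    (h : IsBasicGenerators (T.alphaStar n) S) {rep : T.IntegralPoint n → T.LabelledPoint n}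
    (hrep : ∀ P, T.toIntegralPoint (rep P) = P) :
    Function.Bijective
      ((Ideal.Quotient.mkₐ ℂ (T.sliceIdeal rep S)).comp (T.invariantRing n).val) := by
  obtain ⟨ρ, h1, h2, h3, h4⟩ := T.exists_coordProj h hrep
  constructor
  · rw [injective_iff_map_eq_zero]
    rintro ⟨f, hf⟩ h0
    exact Subtype.ext ((h4 f hf).symm.trans (h3 f (Ideal.Quotient.eq_zero_iff_mem.1 h0)))
  · intro g
    obtain ⟨f, rfl⟩ := Ideal.Quotient.mk_surjective g
    exact ⟨⟨ρ f, h1 f⟩, h2 f⟩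

end CoordinateRing

/-! ### Orbits, the slice and regular functions. -/

section Points

variable {K : Type*} (T : IdealTriangulation K) {n : ℕ}

theorem smul_apply (x : T.Torus n) (c : T.ptolemyVariety n) (p : T.LabelledPoint n) :
    (x • c).1 p = (T.character x p : ℂ) * c.1 p := rfl

/-! ### Orbits and the slice -/

/-- Applying `q` rewrites any weight as the weight of a combination of points of `S`. -/
theorem character_eq_one {S : Set (T.IntegralPoint n)}
    (h : IsBasicGenerators (T.alphaStar n) S) {rep : T.IntegralPoint n → T.LabelledPoint n}
    (hrep : ∀ P, T.toIntegralPoint (rep P) = P) (x : T.Torus n)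
    (hx : ∀ P ∈ S, T.character x (rep P) = 1) (p : T.LabelledPoint n) : T.character x p = 1 := by
  obtain ⟨q, -, hq', hspan, -⟩ := h.exists_projection
  have h1 := T.torusHom_weight x p
  rw [← alphaStar_single, ← hq'] at h1
  rw [← toMul_ofMul (T.character x p), ← h1, T.torusHom_alphaStar x hrep]
  exact T.laurent_eq_one _ hx (hspan _)

/-- Every orbit meets the slice. -/
theorem exists_smul_mem_slice {S : Set (T.IntegralPoint n)}
    (h : IsBasicGenerators (T.alphaStar n) S) {rep : T.IntegralPoint n → T.LabelledPoint n}
    (hrep : ∀ P, T.toIntegralPoint (rep P) = P) (c : T.ptolemyVariety n) :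
    ∃ x : T.Torus n, (x • c).1 ∈ T.slice rep S := by
  let s := Submodule.span ℤ ((fun P : T.IntegralPoint n => Finsupp.single P (1 : ℤ)) '' S)
  -- The homomorphism `P ↦ c_P⁻¹`, written additively. As `α*` is injective on `Span(S)`, its
  -- restriction there extends along `α*` to `C₀ⁿ`, that is, to a torus element.
  let g : T.C1 n →ₗ[ℤ] Additive ℂˣ :=
    -Finsupp.linearCombination ℤ fun P => Additive.ofMul (Units.mk0 (c.1 (rep P)) (c.2.1 _))
  obtain ⟨f, hf⟩ := baer_units_complex.extension_property (T.alphaStar n ∘ₗ s.subtype)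
    (fun v w hvw => Subtype.ext (h.1 v.2 w.2 hvw)) (g ∘ₗ s.subtype)
  obtain ⟨x, rfl⟩ := T.exists_torusHom_eq f
  refine ⟨x, (x • c).2, fun P hP => ?_⟩
  have h1 := LinearMap.congr_fun hf ⟨Finsupp.single P 1, Submodule.subset_span ⟨P, hP, rfl⟩⟩
  have h2 := T.torusHom_weight x (rep P)
  rw [hrep] at h2
  simp only [LinearMap.comp_apply, Submodule.subtype_apply, alphaStar_single, h2, g,
    LinearMap.neg_apply, Finsupp.linearCombination_single, one_smul] at h1
  have h3 : T.character x (rep P) = (Units.mk0 (c.1 (rep P)) (c.2.1 _))⁻¹ :=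
    congrArg Additive.toMul h1
  rw [smul_apply, h3]
  exact Units.inv_mul (Units.mk0 (c.1 (rep P)) (c.2.1 _))

theorem bijective_slice_to_quotient {S : Set (T.IntegralPoint n)}
    (h : IsBasicGenerators (T.alphaStar n) S) {rep : T.IntegralPoint n → T.LabelledPoint n}
    (hrep : ∀ P, T.toIntegralPoint (rep P) = P) :
    Function.Bijective
      (fun c : T.slice rep S => (Quotient.mk _ ⟨c.1, c.2.1⟩ : T.ReducedPtolemyVariety n)) := by
  constructor
  · rintro ⟨c, hc⟩ ⟨c', hc'⟩ hcc
    obtain ⟨x, hx⟩ : ∃ x : T.Torus n, x • (⟨c', hc'.1⟩ : T.ptolemyVariety n) = ⟨c, hc.1⟩ :=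
      Quotient.exact hcc
    have hx' : ∀ p, (T.character x p : ℂ) * c' p = c p := fun p =>
      congrFun (congrArg Subtype.val hx) p
    have h1 : ∀ P ∈ S, T.character x (rep P) = 1 := by
      intro P hP
      have := hx' (rep P)
      rw [hc.2 P hP, hc'.2 P hP, mul_one] at this
      exact Units.ext this
    apply Subtype.ext
    funext p
    have := hx' p
    rw [T.character_eq_one h hrep x h1 p, Units.val_one, one_mul] at this
    exact this.symm
  · intro y
    obtain ⟨c, rfl⟩ := Quotient.exists_rep y
    obtain ⟨x, hx⟩ := T.exists_smul_mem_slice h hrep c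
    exact ⟨⟨_, hx⟩, Quotient.sound ⟨x, rfl⟩⟩

/-! ### Regular functions -/

theorem aeval_relation (c : T.ptolemyVariety n) : ∀ f ∈ T.relationIdeal n,
    MvPolynomial.aeval (R := ℂ) (Sum.elim c.1 fun p => (c.1 p)⁻¹) f = 0 := by
  suffices T.relationIdeal n ≤
    RingHom.ker (MvPolynomial.aeval (R := ℂ) (Sum.elim c.1 fun p => (c.1 p)⁻¹)) from
    fun f hf => this hf
  rw [relationIdeal, Ideal.span_le]
  obtain ⟨h1, h2, h3⟩ := c.2
  rintro f (⟨k, a, ha, rfl⟩ | ⟨p, i, hp, rfl⟩ | ⟨p, rfl⟩) <;> rw [SetLike.mem_coe, RingHom.mem_ker]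
  · refine Eq.trans ?_ (h2 k a ha)
    simp only [ptolemyExpr, map_sub, map_add, map_mul, MvPolynomial.aeval_X, Sum.elim_inl]
  · simp only [map_sub, map_mul, MvPolynomial.aeval_X, Sum.elim_inl, MvPolynomial.algHom_C]
    exact sub_eq_zero.2 (h3 p i hp)
  · simp only [map_sub, map_mul, map_one, MvPolynomial.aeval_X, Sum.elim_inl, Sum.elim_inr]
    rw [mul_inv_cancel₀ (h1 p), sub_self]

/-- Evaluation of an element of the coordinate ring at a point of the Ptolemy variety. -/
noncomputable def evalAt (c : T.ptolemyVariety n) : T.CoordRing n →ₐ[ℂ] ℂ :=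
  Ideal.Quotient.liftₐ _ (MvPolynomial.aeval (Sum.elim c.1 fun p => (c.1 p)⁻¹))
    (T.aeval_relation c)

theorem evalAt_mk (c : T.ptolemyVariety n) (F : T.PolyRing n) :
    T.evalAt c (Ideal.Quotient.mk (T.relationIdeal n) F) =
      MvPolynomial.aeval (Sum.elim c.1 fun p => (c.1 p)⁻¹) F := rfl

theorem evalAt_smul (x : T.Torus n) (c : T.ptolemyVariety n) (f : T.CoordRing n) :
    T.evalAt (x • c) f = T.evalAt c (T.coordAct x f) := by
  obtain ⟨F, rfl⟩ := Ideal.Quotient.mk_surjective f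
  have h : T.coordAct x (Ideal.Quotient.mk (T.relationIdeal n) F) =
    Ideal.Quotient.mk (T.relationIdeal n) (T.polyAct x F) := rfl
  rw [h, evalAt_mk, evalAt_mk, ← AlgHom.comp_apply]
  congr 1
  refine MvPolynomial.algHom_ext fun v => ?_
  obtain p | p := v
  · simp [polyAct, smul_apply]
  · simp [polyAct, smul_apply, mul_comm]

/-- Regular functions are evaluations of elements of `𝒪`. This lets `ρ` act on functions without
comparing the relation ideal with the vanishing ideal of the variety. -/
theorem mem_regularFunctions {V : Set (T.LabelledPoint n → ℂ)} (hV : V ⊆ T.ptolemyVariety n)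
    (f : V → ℂ) : f ∈ T.regularFunctions V ↔
      ∃ F : T.CoordRing n, ∀ c : V, f c = T.evalAt ⟨c.1, hV c.2⟩ F := by
  have h1 : T.regularFunctions V = (MvPolynomial.aeval (R := ℂ) (Sum.elim
      (fun (p : T.LabelledPoint n) (c : V) => c.1 p) fun p (c : V) => (c.1 p)⁻¹)).range := by
    rw [← Algebra.adjoin_range_eq_range_aeval, Set.Sum.elim_range]
    rfl
  have h2 : ∀ (F : T.PolyRing n) (c : V), MvPolynomial.aeval (R := ℂ) (Sum.elim
      (fun (p : T.LabelledPoint n) (c : V) => c.1 p) fun p (c : V) => (c.1 p)⁻¹) F c =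
      T.evalAt ⟨c.1, hV c.2⟩ (Ideal.Quotient.mk (T.relationIdeal n) F) := by
    intro F c
    rw [evalAt_mk]
    change ((Pi.evalAlgHom ℂ (fun _ : V => ℂ) c).comp (MvPolynomial.aeval _)) F = _
    congr 1
    refine MvPolynomial.algHom_ext fun v => ?_
    obtain p | p := v <;> simp
  rw [h1, AlgHom.mem_range]
  constructor
  · rintro ⟨F, rfl⟩
    exact ⟨_, h2 F⟩
  · rintro ⟨F, hF⟩
    obtain ⟨F, rfl⟩ := Ideal.Quotient.mk_surjective F
    exact ⟨F, funext fun c => (h2 F c).trans (hF c).symm⟩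

theorem slice_subset (rep : T.IntegralPoint n → T.LabelledPoint n) (S : Set (T.IntegralPoint n)) :
    T.slice rep S ⊆ T.ptolemyVariety n := fun _ hc => hc.1

theorem evalAt_eq_of_mem_slice {S : Set (T.IntegralPoint n)}
    {rep : T.IntegralPoint n → T.LabelledPoint n} (c : T.slice rep S) {f g : T.CoordRing n}
    (h : Ideal.Quotient.mk (T.sliceIdeal rep S) f = Ideal.Quotient.mk (T.sliceIdeal rep S) g) :
    T.evalAt ⟨c.1, c.2.1⟩ f = T.evalAt ⟨c.1, c.2.1⟩ g := by
  rw [← sub_eq_zero, ← map_sub]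
  suffices T.sliceIdeal rep S ≤ RingHom.ker (T.evalAt ⟨c.1, c.2.1⟩) from
    this ((Ideal.Quotient.mk_eq_mk_iff_sub_mem _ _).1 h)
  rw [sliceIdeal, Ideal.span_le]
  rintro _ ⟨P, hP, rfl⟩
  rw [SetLike.mem_coe, RingHom.mem_ker, map_sub, evalAt_mk, map_one, MvPolynomial.aeval_X,
    Sum.elim_inl, c.2.2 P hP, sub_self]

/-- Injectivity holds because every orbit meets the slice. For surjectivity, `ρ` makes a lift
invariant while changing it only by an element of the slice ideal. -/
theorem bijOn_invariantFunctions {S : Set (T.IntegralPoint n)}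
    (h : IsBasicGenerators (T.alphaStar n) S) {rep : T.IntegralPoint n → T.LabelledPoint n}
    (hrep : ∀ P, T.toIntegralPoint (rep P) = P) :
    Set.BijOn (fun f (c : T.slice rep S) => f ⟨c.1, c.2.1⟩)
      (T.invariantFunctions n) (T.regularFunctions (T.slice rep S)) := by
  refine ⟨?_, ?_, ?_⟩
  · rintro f ⟨hf, -⟩
    obtain ⟨F, hF⟩ := (T.mem_regularFunctions subset_rfl f).1 hf
    exact (T.mem_regularFunctions (T.slice_subset rep S) _).2 ⟨F, fun c => hF _⟩
  · rintro f ⟨-, hf⟩ g ⟨-, hg⟩ hfg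
    funext c
    obtain ⟨x, hx⟩ := T.exists_smul_mem_slice h hrep c
    rw [← hf x c, ← hg x c]
    exact congrFun hfg ⟨_, hx⟩
  · intro g hg
    obtain ⟨G, hG⟩ := (T.mem_regularFunctions (T.slice_subset rep S) g).1 hg
    obtain ⟨ρ, h1, h2, -, -⟩ := T.exists_coordProj h hrep
    refine ⟨fun c => T.evalAt c (ρ G), ⟨(T.mem_regularFunctions subset_rfl _).2
      ⟨ρ G, fun _ => rfl⟩, fun x c => ?_⟩, funext fun c => ?_⟩
    · dsimp only
      rw [evalAt_smul, (T.mem_invariantRing _).1 (h1 G)]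
    · rw [hG c]
      exact T.evalAt_eq_of_mem_slice c (h2 G)

end Points

end IdealTriangulation

theorem mainTheorem6 {K : Type*} [Finite K] (T : IdealTriangulation K) (hT : T.IsConnected)
    (n : ℕ) (hn : 2 ≤ n) :
    -- the map `α*` is basic
    IsBasic (T.alphaStar n) ∧
    -- explicit sets of integral points exist in each of the three cases
    ((Nat.card T.Cusp = 1 → ∃ S, T.IsOneCuspFamily n S) ∧
      (1 < Nat.card T.Cusp → T.HasSelfEdge → ∃ S, T.IsOneCycleFamily n S) ∧
      (1 < Nat.card T.Cusp → ¬ T.HasSelfEdge → ∃ S, T.IsThreeCycleFamily n S)) ∧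
    -- their columns form a matrix of determinant `± n`, and they are basic generators
    (∀ S : Set (T.IntegralPoint n),
      (Nat.card T.Cusp = 1 ∧ T.IsOneCuspFamily n S) ∨ T.IsOneCycleFamily n S ∨
        T.IsThreeCycleFamily n S →
      T.ColumnsHaveDet S n ∧ IsBasicGenerators (T.alphaStar n) S) ∧
    -- for every set of basic generators, the reduced variety is the subvariety where their
    -- coordinates are `1`: on points, on regular functions, and on coordinate rings
    ∀ S : Set (T.IntegralPoint n), IsBasicGenerators (T.alphaStar n) S →
      ∀ rep : T.IntegralPoint n → T.LabelledPoint n, (∀ P, T.toIntegralPoint (rep P) = P) →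
      Function.Bijective
        (fun c : T.slice rep S => (Quotient.mk _ ⟨c.1, c.2.1⟩ : T.ReducedPtolemyVariety n)) ∧
      Set.BijOn (fun f (c : T.slice rep S) => f ⟨c.1, c.2.1⟩)
        (T.invariantFunctions n) (T.regularFunctions (T.slice rep S)) ∧
      Function.Bijective
        ((Ideal.Quotient.mkₐ ℂ (T.sliceIdeal rep S)).comp (T.invariantRing n).val) := by
  have hfam : ∀ S : Set (T.IntegralPoint n),
      (Nat.card T.Cusp = 1 ∧ T.IsOneCuspFamily n S) ∨ T.IsOneCycleFamily n S ∨
        T.IsThreeCycleFamily n S →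
      T.ColumnsHaveDet S n ∧ IsBasicGenerators (T.alphaStar n) S := by
    rintro S (⟨hv, h⟩ | h | h)
    · exact T.columnsHaveDet_of_isOneCuspFamily hn hv h
    · exact T.columnsHaveDet_of_isOneCycleFamily hn h
    · exact T.columnsHaveDet_of_isThreeCycleFamily hn h
  refine ⟨?_, ⟨fun _ => T.exists_isOneCuspFamily n hT,
    fun hv h => T.exists_isOneCycleFamily n hT hv h,
    fun _ h => T.exists_isThreeCycleFamily n hT h⟩, hfam, fun S hS rep hrep =>
    ⟨T.bijective_slice_to_quotient hS hrep, T.bijOn_invariantFunctions hS hrep,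
      T.bijective_invariantRing_to_quotient hS hrep⟩⟩
  by_cases hv : Nat.card T.Cusp = 1
  · obtain ⟨S, h⟩ := T.exists_isOneCuspFamily n hT
    exact ⟨S, (hfam S (Or.inl ⟨hv, h⟩)).2⟩
  by_cases h : T.HasSelfEdge
  · obtain ⟨k⟩ := hT.1
    have : Nonempty T.Cusp := ⟨T.cusp k 0⟩
    have := Nat.card_pos (α := T.Cusp)
    obtain ⟨S, h⟩ := T.exists_isOneCycleFamily n hT (by omega) h
    exact ⟨S, (hfam S (Or.inr (Or.inl h))).2⟩
  -- Without self edges the vertices of a simplex lie at distinct cusps, so no count of cusps is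
  -- needed.
  · obtain ⟨S, h⟩ := T.exists_isThreeCycleFamily n hT h
    exact ⟨S, (hfam S (Or.inr (Or.inr h))).2⟩
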